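/- Let $d\ge 1$ and let $S,\Sigma\subset\mathbb{R}^+=[0,\infty)$ be Lebesgue measurable sets with $0<|S|<\infty$ and $0<|\Sigma|<\infty$, where $|\cdot|$ is the one-dimensional Lebesgue measure. Put $S_d=\{x\in\mathbb{R}^d : |x|\in S\}$ and $\Sigma_d=\{\xi\in\mathbb{R}^d : |\xi|\in\Sigma\}$, with $|x|$ the Euclidean norm. For $F\in L^2(\mathbb{R}^d)$ (complex valued) let $\widehat F$ be its Fourier transform, the unitary extension to $L^2(\mathbb{R}^d)$ of $\widehat F(\xi)=\int_{\mathbb{R}^d}F(x)e^{-2i\pi\langle x,\xi\rangle}\,dx$, and write $\operatorname{supp}F\subset A$ if $F=0$ almost everywhere on $\mathbb{R}^d\setminus A$. Then $(S_d,\Sigma_d)$ is a weak annihilating pair for the Fourier transform, that is: if $F\in L^2(\mathbb{R}^d)$ satisfies $\operatorname{supp}F\subset S_d$ and $\operatorname{supp}\widehat F\subset\Sigma_d$, then $F=0$ in $L^2(\mathbb{R}^d)$. -/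

import Mathlib

open MeasureTheory FourierTransform

/-- The radial set `{x ∈ ℝ^d : |x| ∈ S}`, with `|x|` the Euclidean norm. -/
def radialSet (d : ℕ) (S : Set ℝ) : Set (EuclideanSpace ℝ (Fin d)) :=
  {x | ‖x‖ ∈ S}

/-- `F ∈ L²(ℝ^d)` is supported in `A`: the class `F` vanishes almost everywhere off `A`,
that is, `F = χ_A F` in `L²`. -/
def SupportedIn {d : ℕ} (F : Lp ℂ 2 (volume : Measure (EuclideanSpace ℝ (Fin d))))
    (A : Set (EuclideanSpace ℝ (Fin d))) : Prop :=
  ∀ᵐ x ∂(volume : Measure (EuclideanSpace ℝ (Fin d))), x ∉ A → F x = 0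

/-- `(A, B)` is a weak annihilating pair for the Fourier transform on `L²(ℝ^d)`. Here `𝓕` is the
unitary extension to `L²` of `F ↦ ∫ F(x) exp(-2πi⟨x, ξ⟩) dx`. -/
def IsWeakAnnihilatingPair {d : ℕ} (A B : Set (EuclideanSpace ℝ (Fin d))) : Prop :=
  ∀ F : Lp ℂ 2 (volume : Measure (EuclideanSpace ℝ (Fin d))),
    SupportedIn F A → SupportedIn (𝓕 F) B → F = 0

/-!
Suppose that the Gaussian moments `∫ ⟨e, v⟩ ^ j exp (-π s |v|²) F(v) dv` of `F` and `𝓕 F` vanish for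
all `j < k`. Plancherel's formula against modulated Gaussians then relates the `k`-th moment of `F`
at `s` to that of `𝓕 F` at `1 / s`, which says that the spherical averages
`r ^ ((d - 1) / 2) ∫ ⟨e, ω⟩ ^ k F(r ω) dω` of `F` and, up to `i ^ k`, of `𝓕 F` are Hankel transforms
of order `ν = k + d / 2 - 1` of each other in `L²(0, ∞)`.

The Hankel kernel `√t J_ν(t)` is bounded, so the argument of Amrein and Berthier applies. The Hankel
pairs supported in sets `A`, `B` of finite measure form a space of dimension bounded in terms of
`|A| |B|`. If this dimension is maximal among all sets of measures below given bounds, then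
enlarging `A` and `B` slightly does not change the space, which is therefore invariant under a
dilation close to `1`; but an eigenfunction of a dilation cannot have support of finite measure, so
the space is zero. Hence the averages vanish, and with them the `k`-th moments. By induction all
moments vanish, and `F = 0`.
-/

/-! ### Estimates in `L²` and the moment problem -/

section SquareIntegrable

open scoped InnerProductSpace Polynomial

variable {α β E : Type*} [MeasurableSpace α] [MeasurableSpace β] {μ : Measure α} {ν : Measure β}
  [NormedAddCommGroup E]

lemma integrable_of_memLp_two_of_support_finite {f : α → E} (hf : MemLp f 2 μ) {A : Set α}
    (hA : μ A < ⊤) (hfA : ∀ᵐ x ∂μ, x ∉ A → f x = 0) : Integrable f μ := by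
  have : Fact (μ A < ⊤) := ⟨hA⟩
  have integrableOn_A : IntegrableOn f A μ := (hf.restrict A).integrable one_le_two
  exact integrableOn_A.integrable_of_ae_notMem_eq_zero hfA

lemma sq_norm_eq_integral_sq_norm (f : Lp E 2 μ) : ‖f‖ ^ 2 = ∫ x, ‖f x‖ ^ 2 ∂μ := by
  have integral_nonneg : 0 ≤ ∫ x, ‖f x‖ ^ 2 ∂μ := integral_nonneg fun _ => by positivity
  rw [Lp.norm_def, toReal_eLpNorm (Lp.aestronglyMeasurable f),
    lpNorm_eq_integral_norm_rpow_toReal two_ne_zero ENNReal.ofNat_ne_top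
      (Lp.aestronglyMeasurable f)]
  simp only [ENNReal.toReal_ofNat, Real.rpow_two]
  rw [← one_div, ← Real.sqrt_eq_rpow, Real.sq_sqrt integral_nonneg]

lemma sq_norm_integral_mul_le {𝕜 : Type*} [RCLike 𝕜] {f g : α → 𝕜} (hf : MemLp f 2 μ)
    (hg : MemLp g 2 μ) :
    ‖∫ x, f x * g x ∂μ‖ ^ 2 ≤ (∫ x, ‖f x‖ ^ 2 ∂μ) * ∫ x, ‖g x‖ ^ 2 ∂μ := by
  have holder := integral_mul_norm_le_Lp_mul_Lq (μ := μ) Real.HolderConjugate.two_two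
    (f := f) (g := g) (by simpa using hf) (by simpa using hg)
  simp only [Real.rpow_two, ← Real.sqrt_eq_rpow, ← norm_mul] at holder
  calc ‖∫ x, f x * g x ∂μ‖ ^ 2
      ≤ (√(∫ x, ‖f x‖ ^ 2 ∂μ) * √(∫ x, ‖g x‖ ^ 2 ∂μ)) ^ 2 := by
        gcongr
        exact (norm_integral_le_integral_norm _).trans holder
    _ = _ := by
        rw [mul_pow, Real.sq_sqrt (integral_nonneg fun _ => by positivity),
          Real.sq_sqrt (integral_nonneg fun _ => by positivity)]

lemma sum_sq_norm_integral_mul_le {ι : Type*} [Fintype ι] {g : ι → Lp ℂ 2 ν}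
    (hg : ∀ k : Lp ℂ 2 ν, ∑ i, ‖⟪g i, k⟫_ℂ‖ ^ 2 ≤ ‖k‖ ^ 2) {κ : β → ℂ} (hκ : MemLp κ 2 ν) :
    ∑ i, ‖∫ y, κ y * g i y ∂ν‖ ^ 2 ≤ ∫ y, ‖κ y‖ ^ 2 ∂ν := by
  have inner_eq (i : ι) : ⟪hκ.star.toLp (star κ), g i⟫_ℂ = ∫ y, κ y * g i y ∂ν := by
    rw [L2.inner_def]
    refine integral_congr_ae ?_
    filter_upwards [hκ.star.coeFn_toLp] with y hy
    rw [hy, RCLike.inner_apply, Pi.star_apply, starRingEnd_apply, star_star, mul_comm]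
  have norm_eq : ‖hκ.star.toLp (star κ)‖ ^ 2 = ∫ y, ‖κ y‖ ^ 2 ∂ν := by
    rw [sq_norm_eq_integral_sq_norm]
    refine integral_congr_ae ?_
    filter_upwards [hκ.star.coeFn_toLp] with y hy
    rw [hy, Pi.star_apply, norm_star]
  simpa only [norm_inner_symm (g _), inner_eq, norm_eq] using hg (hκ.star.toLp (star κ))

/-- The Hilbert-Schmidt bound: under Bessel's inequality for the `g i`, the total energy of the
images of the `g i` under an integral operator is at most the square integral of its kernel. -/
lemma sum_sq_norm_le_integral_of_ae_eq_integral_mul {ι : Type*} [Fintype ι] {f : ι → Lp ℂ 2 μ}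
    {g : ι → Lp ℂ 2 ν} (hg : ∀ k : Lp ℂ 2 ν, ∑ i, ‖⟪g i, k⟫_ℂ‖ ^ 2 ≤ ‖k‖ ^ 2)
    {κ : α → β → ℂ} (hκ : ∀ᵐ x ∂μ, MemLp (κ x) 2 ν)
    (hf : ∀ i, ∀ᵐ x ∂μ, f i x = ∫ y, κ x y * g i y ∂ν)
    {M : α → ℝ} (hM : Integrable M μ) (hκM : ∀ᵐ x ∂μ, ∫ y, ‖κ x y‖ ^ 2 ∂ν ≤ M x) :
    ∑ i, ‖f i‖ ^ 2 ≤ ∫ x, M x ∂μ := by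
  have integrable_sq (i : ι) : Integrable (fun x => ‖f i x‖ ^ 2) μ :=
    (memLp_two_iff_integrable_sq_norm (Lp.aestronglyMeasurable _)).1 (Lp.memLp (f i))
  simp only [sq_norm_eq_integral_sq_norm]
  rw [← integral_finsetSum _ fun i _ => integrable_sq i]
  refine integral_mono_ae (integrable_finsetSum _ fun i _ => integrable_sq i) hM ?_
  filter_upwards [hκ, hκM, ae_all_iff.2 hf] with x hκx hκMx hfx
  simp only [hfx]
  exact (sum_sq_norm_integral_mul_le hg hκx).trans hκMx

variable [NormedSpace ℝ E]

lemma integrable_continuous_smul_of_ae_mem_Icc {μ : Measure ℝ} {a b : ℝ}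
    (hμ : ∀ᵐ t ∂μ, t ∈ Set.Icc a b) {f : ℝ → E} (hf : Integrable f μ) {g : ℝ → ℝ}
    (hg : Continuous g) : Integrable (fun t => g t • f t) μ := by
  obtain ⟨C, hC⟩ := isCompact_Icc.exists_bound_of_continuousOn (s := Set.Icc a b) hg.continuousOn
  exact hf.bdd_smul C hg.aestronglyMeasurable (hμ.mono hC)

lemma integral_eval_smul_eq_zero {μ : Measure ℝ} {a b : ℝ} (hμ : ∀ᵐ t ∂μ, t ∈ Set.Icc a b)
    {f : ℝ → E} (hf : Integrable f μ) (h : ∀ n : ℕ, ∫ t, t ^ n • f t ∂μ = 0) (p : ℝ[X]) :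
    ∫ t, p.eval t • f t ∂μ = 0 := by
  have integrable_monomial (n : ℕ) : Integrable (fun t => p.coeff n • t ^ n • f t) μ :=
    (integrable_continuous_smul_of_ae_mem_Icc hμ hf (continuous_pow n)).smul (p.coeff n)
  simp only [Polynomial.eval_eq_sum_range, Finset.sum_smul, mul_smul]
  rw [integral_finsetSum _ fun n _ => integrable_monomial n]
  simp only [integral_smul, h, smul_zero, Finset.sum_const_zero]

/-- Uniqueness in the Hausdorff moment problem. -/
lemma ae_eq_zero_of_forall_integral_pow_smul_eq_zero [CompleteSpace E] {μ : Measure ℝ} {a b : ℝ}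
    (hμ : ∀ᵐ t ∂μ, t ∈ Set.Icc a b) {f : ℝ → E} (hf : Integrable f μ)
    (h : ∀ n : ℕ, ∫ t, t ^ n • f t ∂μ = 0) : f =ᵐ[μ] 0 := by
  refine ae_eq_zero_of_integral_contDiff_smul_eq_zero hf.locallyIntegrable fun g hg _ => ?_
  refine norm_le_zero_iff.1 (le_of_forall_pos_le_add fun ε hε => ?_)
  have : 0 ≤ ∫ t, ‖f t‖ ∂μ := integral_nonneg fun _ => norm_nonneg _
  set δ := ε / (∫ t, ‖f t‖ ∂μ + 1) with δ_def
  obtain ⟨p, hp⟩ := exists_polynomial_near_of_continuousOn a b g hg.continuous.continuousOn δ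
    (by positivity)
  calc ‖∫ t, g t • f t ∂μ‖ = ‖∫ t, p.eval t • f t - g t • f t ∂μ‖ := by
        rw [integral_sub (integrable_continuous_smul_of_ae_mem_Icc hμ hf p.continuous)
          (integrable_continuous_smul_of_ae_mem_Icc hμ hf hg.continuous),
          integral_eval_smul_eq_zero hμ hf h, zero_sub, norm_neg]
    _ ≤ ∫ t, δ * ‖f t‖ ∂μ := by
        refine norm_integral_le_of_norm_le (hf.norm.const_mul δ) (hμ.mono fun t ht => ?_)
        rw [← sub_smul, norm_smul]
        gcongr
        exact (hp t ht).le
    _ ≤ 0 + ε := by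
        rw [integral_const_mul, zero_add, δ_def, div_mul_eq_mul_div, div_le_iff₀ (by positivity)]
        gcongr
        linarith

lemma ae_eq_zero_of_forall_integral_embedding_pow_smul_eq_zero [CompleteSpace E] {φ : α → ℝ}
    (hφ : MeasurableEmbedding φ) {a b : ℝ} (hab : ∀ᵐ x ∂μ, φ x ∈ Set.Icc a b) {f : α → E}
    (hf : Integrable f μ) (h : ∀ n : ℕ, ∫ x, φ x ^ n • f x ∂μ = 0) : f =ᵐ[μ] 0 := by
  have extend_apply (x : α) : Function.extend φ f 0 (φ x) = f x := hφ.injective.extend_apply f 0 x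
  have extend_ae_eq_zero : Function.extend φ f 0 =ᵐ[μ.map φ] 0 := by
    refine ae_eq_zero_of_forall_integral_pow_smul_eq_zero (hφ.ae_map_iff.2 hab)
      (hφ.integrable_map_iff.2 ?_) fun n => ?_
    · simpa only [Function.comp_def, extend_apply] using hf
    · simpa only [hφ.integral_map, extend_apply] using h n
  filter_upwards [hφ.ae_map_iff.1 extend_ae_eq_zero] with x hx
  rwa [extend_apply] at hx

end SquareIntegrable

/-! ### Bessel functions -/

section Bessel

/-- The `m`-th Taylor coefficient of `besselSeries a`. -/
noncomputable def besselCoeff (a : ℝ) (m : ℕ) : ℝ :=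
  (-1) ^ m / (m.factorial * Real.Gamma (m + a + 1 / 2))

/-- The entire function through which the Bessel function of order `a - 1/2` is defined:
`J_{a - 1/2}(2 t) = t ^ (a - 1/2) * besselSeries a (t ^ 2)`. The order is shifted by `1/2` because
`a` is then the exponent of the weight `x ^ a` in the Hankel transform on `L²(0, ∞)`. -/
noncomputable def besselSeries (a z : ℝ) : ℝ := ∑' m : ℕ, besselCoeff a m * z ^ m

lemma besselCoeff_succ_mul (a : ℝ) (m : ℕ) :
    besselCoeff a (m + 1) * (m + 1) = -besselCoeff (a + 1) m := by
  have gamma_arg : ((m + 1 : ℕ) : ℝ) + a + 1 / 2 = m + (a + 1) + 1 / 2 := by push_cast; ring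
  rw [besselCoeff, besselCoeff, gamma_arg, Nat.factorial_succ]
  push_cast
  field_simp
  ring

variable {a : ℝ}

lemma besselCoeff_eq_mul_besselCoeff_add_one (ha : 0 ≤ a) (m : ℕ) :
    besselCoeff a m = (m + a + 1 / 2) * besselCoeff (a + 1) m := by
  have gamma_arg : (m : ℝ) + (a + 1) + 1 / 2 = m + a + 1 / 2 + 1 := by ring
  have order_ne_zero : (m : ℝ) + a + 1 / 2 ≠ 0 := by positivity
  rw [besselCoeff, besselCoeff, gamma_arg, Real.Gamma_add_one order_ne_zero]
  field_simp

lemma summable_besselCoeff_mul_pow (ha : 0 ≤ a) (z : ℝ) :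
    Summable fun m : ℕ => besselCoeff a m * z ^ m := by
  refine summable_of_ratio_norm_eventually_le (r := 1 / 2) (by norm_num) ?_
  filter_upwards [Filter.eventually_ge_atTop ⌈4 * |z|⌉₊] with m hm
  have ratio : besselCoeff a (m + 1) * z ^ (m + 1) =
      -(z / ((m + a + 1 / 2) * (m + 1))) * (besselCoeff a m * z ^ m) := by
    have coeff_succ : besselCoeff a (m + 1) = -besselCoeff (a + 1) m / (m + 1) :=
      eq_div_of_mul_eq (by positivity) (besselCoeff_succ_mul a m)
    rw [besselCoeff_eq_mul_besselCoeff_add_one ha m, coeff_succ]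
    field_simp
    ring
  rw [ratio, norm_mul, norm_neg, norm_div, Real.norm_eq_abs z, Real.norm_of_nonneg (by positivity)]
  refine mul_le_mul_of_nonneg_right ?_ (norm_nonneg _)
  rw [div_le_iff₀ (by positivity)]
  have z_le : 4 * |z| ≤ m := Nat.ceil_le.1 hm
  nlinarith [mul_nonneg ha (Nat.cast_nonneg (α := ℝ) m), Nat.cast_nonneg (α := ℝ) m]

lemma hasSum_besselCoeff_mul_deriv_pow (ha : 0 ≤ a) (z : ℝ) :
    HasSum (fun m : ℕ => besselCoeff a m * (m * z ^ (m - 1))) (-besselSeries (a + 1) z) := by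
  refine (hasSum_nat_add_iff' 1).1 ?_
  simp only [Finset.sum_range_one, Nat.cast_zero, zero_mul, mul_zero, sub_zero,
    add_tsub_cancel_right, Nat.cast_add, Nat.cast_one, ← mul_assoc, besselCoeff_succ_mul, neg_mul]
  exact (summable_besselCoeff_mul_pow (add_nonneg ha zero_le_one) z).hasSum.neg

lemma hasDerivAt_besselSeries (ha : 0 ≤ a) (z : ℝ) :
    HasDerivAt (besselSeries a) (-besselSeries (a + 1) z) z := by
  let R := |z| + 1
  have z_mem : z ∈ Metric.ball (0 : ℝ) R := by simp [R]
  have summable_bound : Summable fun m : ℕ => ‖besselCoeff a m * (m * R ^ (m - 1))‖ :=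
    (hasSum_besselCoeff_mul_deriv_pow ha R).summable.norm
  have deriv_tsum := hasDerivAt_tsum_of_isPreconnected
    (g := fun m y => besselCoeff a m * y ^ m)
    (g' := fun m y => besselCoeff a m * (m * y ^ (m - 1))) summable_bound
    Metric.isOpen_ball (convex_ball (0 : ℝ) R).isPreconnected
    (fun m y _ => (hasDerivAt_pow m y).const_mul _)
    (fun m y hy => by
      rw [Metric.mem_ball, dist_zero_right] at hy
      simp only [norm_mul, norm_pow]
      gcongr
      exact hy.le.trans (le_abs_self R)) z_mem (summable_besselCoeff_mul_pow ha z) z_mem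
  rwa [(hasSum_besselCoeff_mul_deriv_pow ha z).tsum_eq] at deriv_tsum

lemma continuous_besselSeries (ha : 0 ≤ a) : Continuous (besselSeries a) :=
  continuous_iff_continuousAt.2 fun z => (hasDerivAt_besselSeries ha z).continuousAt

lemma mul_besselSeries_add_two (ha : 0 ≤ a) (z : ℝ) :
    z * besselSeries (a + 2) z = (a + 1 / 2) * besselSeries (a + 1) z - besselSeries a z := by
  have ha1 : 0 ≤ a + 1 := add_nonneg ha zero_le_one
  have sum_lhs := (hasSum_besselCoeff_mul_deriv_pow ha1 z).mul_left (-z)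
  have sum_rhs := ((summable_besselCoeff_mul_pow ha1 z).hasSum.mul_left (a + 1 / 2)).sub
    (summable_besselCoeff_mul_pow ha z).hasSum
  have termwise (m : ℕ) : -z * (besselCoeff (a + 1) m * (m * z ^ (m - 1))) =
      (a + 1 / 2) * (besselCoeff (a + 1) m * z ^ m) - besselCoeff a m * z ^ m := by
    rw [besselCoeff_eq_mul_besselCoeff_add_one ha]
    cases m with
    | zero => simp
    | succ m => rw [Nat.add_sub_cancel]; ring
  have := sum_lhs.unique (sum_rhs.congr_fun termwise)
  rw [add_assoc, one_add_one_eq_two, neg_mul_neg] at this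
  exact this

/-- The function `t ↦ √t * J_{a - 1/2}(2 t)`. -/
noncomputable def besselKernel (a t : ℝ) : ℝ := t ^ a * besselSeries a (t ^ 2)

lemma continuous_besselKernel (ha : 0 ≤ a) : Continuous (besselKernel a) :=
  (Real.continuous_rpow_const ha).mul ((continuous_besselSeries ha).comp (continuous_pow 2))

lemma hasDerivAt_besselKernel (ha : 0 ≤ a) {t : ℝ} (ht : 0 < t) :
    HasDerivAt (besselKernel a) (a / t * besselKernel a t - 2 * besselKernel (a + 1) t) t := by
  have deriv_rpow := Real.hasDerivAt_rpow_const (x := t) (p := a) (Or.inl ht.ne')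
  have deriv_series := (hasDerivAt_besselSeries ha (t ^ 2)).comp t (hasDerivAt_pow 2 t)
  refine HasDerivAt.congr_deriv (f := besselKernel a) (deriv_rpow.mul deriv_series) ?_
  simp only [besselKernel, Real.rpow_sub_one ht.ne', Real.rpow_add_one ht.ne']
  push_cast
  ring

lemma hasDerivAt_besselKernel_add_one (ha : 0 ≤ a) {t : ℝ} (ht : 0 < t) :
    HasDerivAt (besselKernel (a + 1))
      (2 * besselKernel a t - a / t * besselKernel (a + 1) t) t := by
  refine (hasDerivAt_besselKernel (add_nonneg ha zero_le_one) ht).congr_deriv ?_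
  have recurrence := mul_besselSeries_add_two ha (t ^ 2)
  simp only [besselKernel, Real.rpow_add_one ht.ne', add_assoc a, one_add_one_eq_two]
  rw [show t ^ (a + 2) = t ^ a * t ^ 2 by rw [Real.rpow_add ht, Real.rpow_two]]
  field_simp
  linear_combination -2 * recurrence

/-- The quantity `p² + q² - (a/t) p q` for `p = besselKernel a` and `q = besselKernel (a + 1)`,
which is constant up to an error of order `t⁻²`, times the factor `exp (a/t)` that makes it
decreasing. -/
noncomputable def besselEnergy (a t : ℝ) : ℝ :=
  (besselKernel a t ^ 2 + besselKernel (a + 1) t ^ 2 -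
    a / t * (besselKernel a t * besselKernel (a + 1) t)) * Real.exp (a / t)

lemma hasDerivAt_besselEnergy (ha : 0 ≤ a) {t : ℝ} (ht : 0 < t) :
    HasDerivAt (besselEnergy a)
      (a / t ^ 2 * (besselKernel a t * besselKernel (a + 1) t -
        (besselKernel a t ^ 2 + besselKernel (a + 1) t ^ 2 -
          a / t * (besselKernel a t * besselKernel (a + 1) t))) * Real.exp (a / t)) t := by
  have deriv_p := hasDerivAt_besselKernel ha ht
  have deriv_q := hasDerivAt_besselKernel_add_one ha ht
  have deriv_div : HasDerivAt (fun t : ℝ => a / t) (-(a / t ^ 2)) t :=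
    ((hasDerivAt_inv ht.ne').const_mul a).congr_deriv (by ring)
  refine HasDerivAt.congr_deriv (f := besselEnergy a)
    ((((deriv_p.pow 2).add (deriv_q.pow 2)).sub (deriv_div.mul (deriv_p.mul deriv_q))).mul
      deriv_div.exp) ?_
  simp only [Pi.add_apply, Pi.pow_apply, Pi.sub_apply, Pi.mul_apply]
  push_cast
  ring

lemma half_sq_add_sq_le (ha : 0 ≤ a) {t : ℝ} (hat : a ≤ t) (p q : ℝ) :
    (p ^ 2 + q ^ 2) / 2 ≤ p ^ 2 + q ^ 2 - a / t * (p * q) := by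
  have ratio_nonneg : 0 ≤ a / t := div_nonneg ha (ha.trans hat)
  have ratio_le_one : a / t ≤ 1 := div_le_one_of_le₀ hat (ha.trans hat)
  nlinarith [mul_nonneg ratio_nonneg (sq_nonneg (p - q)),
    mul_nonneg (sub_nonneg.2 ratio_le_one) (add_nonneg (sq_nonneg p) (sq_nonneg q))]

lemma antitoneOn_besselEnergy (ha : 0 ≤ a) : AntitoneOn (besselEnergy a) (Set.Ici (a + 1)) := by
  have pos_of_mem {t : ℝ} (ht : t ∈ Set.Ici (a + 1)) : 0 < t :=
    lt_of_lt_of_le (by positivity) (Set.mem_Ici.1 ht)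
  refine antitoneOn_of_hasDerivWithinAt_nonpos (convex_Ici _)
    (fun t ht => (hasDerivAt_besselEnergy ha (pos_of_mem ht)).continuousAt.continuousWithinAt)
    (fun t ht => (hasDerivAt_besselEnergy ha
      (pos_of_mem (interior_subset ht))).hasDerivWithinAt) fun t ht => ?_
  have ht : a + 1 ≤ t := interior_subset ht
  have quadratic_form_ge := half_sq_add_sq_le ha (by linarith : a ≤ t) (besselKernel a t)
    (besselKernel (a + 1) t)
  refine mul_nonpos_of_nonpos_of_nonneg
    (mul_nonpos_of_nonneg_of_nonpos (by positivity) ?_) (Real.exp_pos _).le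
  nlinarith [sq_nonneg (besselKernel a t - besselKernel (a + 1) t)]

lemma besselKernel_sq_le_besselEnergy (ha : 0 ≤ a) {t : ℝ} (ht : a + 1 ≤ t) :
    besselKernel a t ^ 2 ≤ 2 * besselEnergy a t := by
  have quadratic_form_ge := half_sq_add_sq_le ha (by linarith : a ≤ t) (besselKernel a t)
    (besselKernel (a + 1) t)
  have one_le_exp : 1 ≤ Real.exp (a / t) := Real.one_le_exp (div_nonneg ha (by linarith))
  have energy_ge := quadratic_form_ge.trans
    (le_mul_of_one_le_right (le_trans (by positivity) quadratic_form_ge) one_le_exp)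
  rw [besselEnergy]
  linarith [sq_nonneg (besselKernel (a + 1) t)]

lemma exists_abs_besselKernel_le (ha : 0 ≤ a) : ∃ C, ∀ t, 0 ≤ t → |besselKernel a t| ≤ C := by
  obtain ⟨C, hC⟩ := (isCompact_Icc (a := (0 : ℝ)) (b := a + 1)).exists_bound_of_continuousOn
    (continuous_besselKernel ha).continuousOn
  refine ⟨max C √(2 * besselEnergy a (a + 1)), fun t ht => ?_⟩
  rcases le_total t (a + 1) with hta | hta
  · exact (hC t ⟨ht, hta⟩).trans (le_max_left _ _)
  · refine (Real.abs_le_sqrt ?_).trans (le_max_right _ _)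
    have := antitoneOn_besselEnergy ha (Set.mem_Ici.2 le_rfl) (Set.mem_Ici.2 hta) hta
    linarith [besselKernel_sq_le_besselEnergy ha hta]

end Bessel

section WeightedGaussian

/-- Lebesgue measure on the half line `(0, ∞)`. -/
noncomputable abbrev halfLine : Measure ℝ := volume.restrict (Set.Ioi 0)

/-- The weighted Gaussian `x ^ a * exp (-π s x²)`. The span of these functions is dense in
`L²(0, ∞)` and stable under the Hankel transform of order `a - 1/2`. -/
noncomputable def weightedGaussian (a s x : ℝ) : ℝ := x ^ a * Real.exp (-(Real.pi * s) * x ^ 2)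

variable {a s : ℝ}

lemma continuous_weightedGaussian (ha : 0 ≤ a) (s : ℝ) : Continuous (weightedGaussian a s) := by
  have := Real.continuous_rpow_const ha
  unfold weightedGaussian
  fun_prop

lemma memLp_weightedGaussian (ha : 0 ≤ a) (hs : 0 < s) :
    MemLp (weightedGaussian a s) 2 halfLine := by
  rw [memLp_two_iff_integrable_sq (continuous_weightedGaussian ha s).aestronglyMeasurable]
  have hq : -1 < 2 * a := by linarith
  have hb : 0 < 2 * (Real.pi * s) := by positivity
  refine ((integrable_rpow_mul_exp_neg_mul_sq hb hq).integrableOn (s := Set.Ioi 0)).congr ?_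
  filter_upwards [ae_restrict_mem measurableSet_Ioi] with x (hx : 0 < x)
  rw [weightedGaussian, mul_pow, ← Real.rpow_mul_natCast hx.le, ← Real.exp_nat_mul]
  push_cast
  ring_nf

lemma integrable_weightedGaussian (ha : 0 ≤ a) (hs : 0 < s) :
    Integrable (weightedGaussian a s) halfLine :=
  (integrable_rpow_mul_exp_neg_mul_sq (by positivity) (by linarith)).integrableOn

lemma integrable_weightedGaussian_smul (ha : 0 ≤ a) (hs : 0 < s) {f : ℝ → ℂ}
    (hf : MemLp f 2 halfLine) : Integrable (fun x => weightedGaussian a s x • f x) halfLine :=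
  memLp_one_iff_integrable.1 (hf.smul (memLp_weightedGaussian ha hs))

lemma integral_rpow_mul_exp_neg_mul_sq {q b : ℝ} (hq : -1 < q) (hb : 0 < b) :
    ∫ x in Set.Ioi (0 : ℝ), x ^ q * Real.exp (-b * x ^ 2) =
      b ^ (-((q + 1) / 2)) * (1 / 2) * Real.Gamma ((q + 1) / 2) := by
  have := integral_rpow_mul_exp_neg_mul_rpow (p := 2) (by norm_num) hq hb
  simp only [Real.rpow_two] at this
  rw [this, neg_div]

lemma integral_besselCoeff_mul_rpow_mul_exp_neg_mul_sq (ha : 0 ≤ a) {b : ℝ} (hb : 0 < b) (w : ℝ)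
    (m : ℕ) :
    ∫ x, besselCoeff a m * w ^ m * (x ^ (2 * a + 2 * m) * Real.exp (-b * x ^ 2)) ∂halfLine =
      b ^ (-(a + 1 / 2)) / 2 * ((-(w / b)) ^ m / m.factorial) := by
  have : 0 < Real.Gamma (m + a + 1 / 2) := Real.Gamma_pos_of_pos (by positivity)
  rw [integral_const_mul,
    integral_rpow_mul_exp_neg_mul_sq (by linarith [Nat.cast_nonneg (α := ℝ) m]) hb,
    show (2 * a + 2 * (m : ℝ) + 1) / 2 = m + a + 1 / 2 by ring,
    show -((m : ℝ) + a + 1 / 2) = -(a + 1 / 2) + -(m : ℝ) by ring, Real.rpow_add hb,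
    Real.rpow_neg hb.le (m : ℝ), Real.rpow_natCast, besselCoeff, neg_pow (w / b), div_pow]
  field_simp

lemma abs_besselCoeff_mul_pow (ha : 0 ≤ a) (m : ℕ) (w : ℝ) :
    |besselCoeff a m * w ^ m| = besselCoeff a m * (-|w|) ^ m := by
  have : 0 < Real.Gamma (m + a + 1 / 2) := Real.Gamma_pos_of_pos (by positivity)
  rw [besselCoeff, abs_mul, abs_div, abs_pow, abs_neg, abs_one, one_pow, abs_pow, neg_pow |w|,
    abs_of_pos (by positivity), div_mul_eq_mul_div, div_mul_eq_mul_div, ← mul_assoc, ← mul_pow]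
  norm_num

lemma tsum_besselCoeff_mul_rpow (a w : ℝ) {x : ℝ} (hx : 0 < x) :
    ∑' m : ℕ, besselCoeff a m * w ^ m * x ^ (2 * a + 2 * m) =
      x ^ (2 * a) * besselSeries a (w * x ^ 2) := by
  rw [besselSeries, ← tsum_mul_left]
  refine tsum_congr fun m => ?_
  rw [Real.rpow_add hx, Real.rpow_mul hx.le 2 m, Real.rpow_two, Real.rpow_natCast, mul_pow]
  ring

/-- Weber's integral, by integrating the Taylor series of the Bessel function term by term. -/
lemma integral_rpow_mul_besselSeries_mul_exp_neg_mul_sq (ha : 0 ≤ a) {b : ℝ} (hb : 0 < b)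
    (w : ℝ) :
    ∫ x, x ^ (2 * a) * besselSeries a (w * x ^ 2) * Real.exp (-b * x ^ 2) ∂halfLine =
      b ^ (-(a + 1 / 2)) / 2 * Real.exp (-(w / b)) := by
  set term : ℝ → ℕ → ℝ → ℝ := fun w m x =>
    besselCoeff a m * w ^ m * (x ^ (2 * a + 2 * m) * Real.exp (-b * x ^ 2)) with term_def
  have integral_term (w : ℝ) (m : ℕ) : ∫ x, term w m x ∂halfLine =
      b ^ (-(a + 1 / 2)) / 2 * ((-(w / b)) ^ m / m.factorial) :=
    integral_besselCoeff_mul_rpow_mul_exp_neg_mul_sq ha hb w m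
  have integrable_term (m : ℕ) : Integrable (term w m) halfLine :=
    ((integrable_rpow_mul_exp_neg_mul_sq hb
      (by linarith [Nat.cast_nonneg (α := ℝ) m])).integrableOn).const_mul _
  have norm_term (m : ℕ) : ∀ x ∈ Set.Ioi (0 : ℝ), ‖term w m x‖ = term (-|w|) m x := fun x hx => by
    rw [term_def, norm_mul, Real.norm_eq_abs, abs_besselCoeff_mul_pow ha, Real.norm_of_nonneg
      (mul_nonneg (Real.rpow_nonneg (Set.mem_Ioi.1 hx).le _) (Real.exp_pos _).le)]
  have tsum_term : ∀ x ∈ Set.Ioi (0 : ℝ), ∑' m, term w m x =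
      x ^ (2 * a) * besselSeries a (w * x ^ 2) * Real.exp (-b * x ^ 2) := fun x hx => by
    simp only [term_def, ← mul_assoc, tsum_mul_right]
    rw [tsum_besselCoeff_mul_rpow a w hx]
  have summable_norm : Summable fun m => ∫ x, ‖term w m x‖ ∂halfLine := by
    refine ((Real.summable_pow_div_factorial (-(-|w| / b))).mul_left
      (b ^ (-(a + 1 / 2)) / 2)).congr fun m => ?_
    rw [setIntegral_congr_fun measurableSet_Ioi (norm_term m), integral_term]
  have hasSum_integral := hasSum_integral_of_summable_integral_norm integrable_term summable_norm
  rw [setIntegral_congr_fun measurableSet_Ioi tsum_term] at hasSum_integral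
  simp only [integral_term] at hasSum_integral
  have hasSum_exp := NormedSpace.expSeries_div_hasSum_exp (-(w / b))
  rw [← Real.exp_eq_exp_ℝ] at hasSum_exp
  exact hasSum_integral.unique (hasSum_exp.mul_left _)

lemma injective_mul_abs_self : Function.Injective fun x : ℝ => x * |x| := by
  intro x y (hxy : x * |x| = y * |y|)
  rcases abs_cases x with ⟨hx, _⟩ | ⟨hx, _⟩ <;> rcases abs_cases y with ⟨hy, _⟩ | ⟨hy, _⟩ <;>
    rw [hx, hy] at hxy <;> nlinarith

/-- Uniqueness for the Laplace transform, from that of moments after the substitution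
`t = exp (-π x²)`. -/
lemma ae_eq_zero_of_integral_weightedGaussian {f : ℝ → ℂ}
    (hf : Integrable (fun x => weightedGaussian a 1 x • f x) halfLine)
    (h : ∀ s, 0 < s → ∫ x, weightedGaussian a s x • f x ∂halfLine = 0) : f =ᵐ[halfLine] 0 := by
  -- The variable `t`, extended to an injective function on the whole line.
  let φ : ℝ → ℝ := fun x => Real.exp (-Real.pi * (x * |x|))
  have embedding_φ : MeasurableEmbedding φ :=
    (by fun_prop : Continuous φ).measurableEmbedding <| Real.exp_injective.comp <|
      (mul_right_injective₀ (neg_ne_zero.2 Real.pi_ne_zero)).comp injective_mul_abs_self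
  have φ_mem : ∀ᵐ x ∂halfLine, φ x ∈ Set.Icc 0 1 := by
    filter_upwards [ae_restrict_mem measurableSet_Ioi] with x (hx : 0 < x)
    refine ⟨(Real.exp_pos _).le, Real.exp_le_one_iff.2 ?_⟩
    rw [neg_mul, Left.neg_nonpos_iff]
    positivity
  have gaussian_succ (n : ℕ) : ∀ x ∈ Set.Ioi (0 : ℝ),
      φ x ^ n * weightedGaussian a 1 x = weightedGaussian a (n + 1) x := fun x hx => by
    simp only [φ, weightedGaussian, abs_of_pos (Set.mem_Ioi.1 hx), ← Real.exp_nat_mul]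
    rw [mul_left_comm, ← Real.exp_add]
    ring_nf
  have gaussian_smul_eq_zero :=
    ae_eq_zero_of_forall_integral_embedding_pow_smul_eq_zero embedding_φ φ_mem hf fun n => by
      rw [← h (n + 1) (by positivity)]
      refine setIntegral_congr_fun measurableSet_Ioi fun x hx => ?_
      rw [smul_smul, gaussian_succ n x hx]
  filter_upwards [gaussian_smul_eq_zero, ae_restrict_mem measurableSet_Ioi] with x hx (hx0 : 0 < x)
  exact (smul_eq_zero.1 hx).resolve_left
    (mul_pos (Real.rpow_pos_of_pos hx0 a) (Real.exp_pos _)).ne'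

end WeightedGaussian

section HankelKernel

/-- The kernel `2π √t J_{a - 1/2}(2π t)` of the unitary Hankel transform of order `a - 1/2` on
`L²(0, ∞)`. -/
noncomputable def hankelKernel (a t : ℝ) : ℝ := 2 * √Real.pi * besselKernel a (Real.pi * t)

variable {a : ℝ}

lemma exists_abs_hankelKernel_le (ha : 0 ≤ a) : ∃ C, ∀ t, 0 ≤ t → |hankelKernel a t| ≤ C := by
  obtain ⟨C, hC⟩ := exists_abs_besselKernel_le ha
  refine ⟨2 * √Real.pi * C, fun t ht => ?_⟩
  rw [hankelKernel, abs_mul, abs_of_nonneg (by positivity : 0 ≤ 2 * √Real.pi)]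
  gcongr
  exact hC _ (by positivity)

lemma continuous_hankelKernel (ha : 0 ≤ a) : Continuous (hankelKernel a) :=
  ((continuous_besselKernel ha).comp (continuous_const_mul _)).const_mul _

lemma integral_hankelKernel_mul_weightedGaussian (ha : 0 ≤ a) {s y : ℝ} (hs : 0 < s)
    (hy : 0 ≤ y) :
    ∫ x, hankelKernel a (x * y) * weightedGaussian a s x ∂halfLine =
      s ^ (-(a + 1 / 2)) * weightedGaussian a s⁻¹ y := by
  have hpi := Real.pi_pos
  have integrand_eq : ∀ x ∈ Set.Ioi (0 : ℝ), hankelKernel a (x * y) * weightedGaussian a s x =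
      2 * √Real.pi * (Real.pi * y) ^ a * (x ^ (2 * a) *
        besselSeries a ((Real.pi * y) ^ 2 * x ^ 2) * Real.exp (-(Real.pi * s) * x ^ 2)) := by
    intro x hx
    have hx : 0 < x := hx
    rw [hankelKernel, besselKernel, weightedGaussian, two_mul a, Real.rpow_add hx, ← mul_pow,
      show Real.pi * (x * y) = Real.pi * y * x by ring,
      Real.mul_rpow (mul_nonneg hpi.le hy) hx.le]
    ring
  have pi_powers_cancel : Real.pi ^ (-(a + 1 / 2)) * (√Real.pi * Real.pi ^ a) = 1 := by
    rw [Real.sqrt_eq_rpow, ← Real.rpow_add hpi, ← Real.rpow_add hpi,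
      show -(a + 1 / 2) + (1 / 2 + a) = 0 by ring, Real.rpow_zero]
  rw [setIntegral_congr_fun measurableSet_Ioi integrand_eq, integral_const_mul,
    integral_rpow_mul_besselSeries_mul_exp_neg_mul_sq ha (by positivity),
    show -((Real.pi * y) ^ 2 / (Real.pi * s)) = -(Real.pi * s⁻¹) * y ^ 2 by field_simp,
    weightedGaussian, Real.mul_rpow hpi.le hs.le, Real.mul_rpow hpi.le hy]
  linear_combination
    s ^ (-(a + 1 / 2)) * y ^ a * Real.exp (-(Real.pi * s⁻¹) * y ^ 2) * pi_powers_cancel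

end HankelKernel

/-! ### The Hankel transform -/

section HankelPair

open scoped InnerProductSpace

/-- `g` is the Hankel transform of `f` of order `a - 1/2`, expressed by testing against the weighted
Gaussians: the Hankel transform maps `weightedGaussian a s` to
`s ^ (-(a + 1/2)) • weightedGaussian a s⁻¹`. -/
def IsHankelPair (a : ℝ) (f g : ℝ → ℂ) : Prop :=
  ∀ s, 0 < s → ∫ x, weightedGaussian a s x • f x ∂halfLine =
    s ^ (-(a + 1 / 2)) • ∫ x, weightedGaussian a s⁻¹ x • g x ∂halfLine

/-- The Hankel transform of order `a - 1/2` as an integral, meaningful for integrable `g`. -/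
noncomputable def hankelTransform (a : ℝ) (g : ℝ → ℂ) (x : ℝ) : ℂ :=
  ∫ y, hankelKernel a (x * y) • g y ∂halfLine

variable {a : ℝ} {f g f' g' : ℝ → ℂ}

namespace IsHankelPair

lemma symm (h : IsHankelPair a f g) : IsHankelPair a g f := by
  intro s hs
  have h_inv := h s⁻¹ (inv_pos.2 hs)
  rw [inv_inv] at h_inv
  rw [h_inv, smul_smul, Real.inv_rpow hs.le, mul_inv_cancel₀ (Real.rpow_pos_of_pos hs _).ne',
    one_smul]

lemma congr_ae (h : IsHankelPair a f g) (hf : f =ᵐ[halfLine] f') (hg : g =ᵐ[halfLine] g') :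
    IsHankelPair a f' g' := by
  intro s hs
  rw [← integral_congr_ae (hf.mono fun x hx => congrArg (weightedGaussian a s x • ·) hx),
    ← integral_congr_ae (hg.mono fun x hx => congrArg (weightedGaussian a s⁻¹ x • ·) hx)]
  exact h s hs

lemma zero (a : ℝ) : IsHankelPair a 0 0 := fun s _ => by
  simp only [Pi.zero_apply, smul_zero, integral_zero]

lemma add (ha : 0 ≤ a) (h : IsHankelPair a f g) (h' : IsHankelPair a f' g')
    (hf : MemLp f 2 halfLine) (hg : MemLp g 2 halfLine) (hf' : MemLp f' 2 halfLine)
    (hg' : MemLp g' 2 halfLine) : IsHankelPair a (f + f') (g + g') := by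
  intro s hs
  have hs' := inv_pos.2 hs
  simp only [Pi.add_apply, smul_add]
  rw [integral_add (integrable_weightedGaussian_smul ha hs hf)
      (integrable_weightedGaussian_smul ha hs hf'),
    integral_add (integrable_weightedGaussian_smul ha hs' hg)
      (integrable_weightedGaussian_smul ha hs' hg'), h s hs, h' s hs, smul_add]

lemma const_smul (h : IsHankelPair a f g) (c : ℂ) : IsHankelPair a (c • f) (c • g) := by
  intro s hs
  simp only [Pi.smul_apply, smul_comm _ c, integral_smul]
  rw [h s hs, smul_comm]

lemma ae_eq_left (h : IsHankelPair a f g) (h' : IsHankelPair a f' g)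
    (hf : ∀ s, 0 < s → Integrable (fun x => weightedGaussian a s x • f x) halfLine)
    (hf' : ∀ s, 0 < s → Integrable (fun x => weightedGaussian a s x • f' x) halfLine) :
    f =ᵐ[halfLine] f' := by
  refine (ae_eq_zero_of_integral_weightedGaussian (a := a) (f := f - f') ?_ fun s hs => ?_).mono
    fun x hx => sub_eq_zero.1 hx
  · simp only [Pi.sub_apply, smul_sub]
    exact (hf 1 one_pos).sub (hf' 1 one_pos)
  · simp only [Pi.sub_apply, smul_sub]
    rw [integral_sub (hf s hs) (hf' s hs), h s hs, h' s hs, sub_self]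

end IsHankelPair

lemma aestronglyMeasurable_hankelKernel_smul (ha : 0 ≤ a) (hg : AEStronglyMeasurable g halfLine) :
    AEStronglyMeasurable (fun p : ℝ × ℝ => hankelKernel a (p.1 * p.2) • g p.2)
      (halfLine.prod halfLine) :=
  ((continuous_hankelKernel ha).comp continuous_mul).aestronglyMeasurable.smul hg.comp_snd

lemma integrable_weightedGaussian_smul_hankelTransform (ha : 0 ≤ a) (hg : Integrable g halfLine)
    {s : ℝ} (hs : 0 < s) :
    Integrable (fun x => weightedGaussian a s x • hankelTransform a g x) halfLine := by
  obtain ⟨C, hC⟩ := exists_abs_hankelKernel_le ha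
  refine (integrable_weightedGaussian ha hs).smul_bdd (C * ∫ y, ‖g y‖ ∂halfLine)
    (aestronglyMeasurable_hankelKernel_smul ha hg.1).integral_prod_right' ?_
  filter_upwards [ae_restrict_mem measurableSet_Ioi] with x (hx : 0 < x)
  rw [← integral_const_mul]
  refine norm_integral_le_of_norm_le (hg.norm.const_mul C) ?_
  filter_upwards [ae_restrict_mem measurableSet_Ioi] with y (hy : 0 < y)
  rw [norm_smul]
  gcongr
  exact hC _ (by positivity)

lemma integrable_prod_weightedGaussian_smul_hankelKernel_smul (ha : 0 ≤ a)
    (hg : Integrable g halfLine) {s : ℝ} (hs : 0 < s) :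
    Integrable (fun p : ℝ × ℝ => weightedGaussian a s p.1 • hankelKernel a (p.1 * p.2) • g p.2)
      (halfLine.prod halfLine) := by
  obtain ⟨C, hC⟩ := exists_abs_hankelKernel_le ha
  have pos_of_ae : ∀ᵐ p ∂(halfLine.prod halfLine), p ∈ Set.Ioi (0 : ℝ) ×ˢ Set.Ioi (0 : ℝ) := by
    rw [halfLine, Measure.prod_restrict]
    exact ae_restrict_mem (measurableSet_Ioi.prod measurableSet_Ioi)
  refine (((integrable_weightedGaussian ha hs).smul_prod hg).smul C).mono
    (((continuous_weightedGaussian ha s).comp continuous_fst).aestronglyMeasurable.smul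
      (aestronglyMeasurable_hankelKernel_smul ha hg.1)) ?_
  filter_upwards [pos_of_ae] with p hp
  rw [Pi.smul_apply, smul_comm]
  simp only [norm_smul]
  gcongr
  exact (hC _ (mul_pos hp.1 hp.2).le).trans (le_abs_self C)

lemma isHankelPair_hankelTransform (ha : 0 ≤ a) (hg : Integrable g halfLine) :
    IsHankelPair a (hankelTransform a g) g := by
  intro s hs
  simp only [hankelTransform, ← integral_smul]
  rw [integral_integral_swap (integrable_prod_weightedGaussian_smul_hankelKernel_smul ha hg hs)]
  refine setIntegral_congr_fun measurableSet_Ioi fun y (hy : 0 < y) => ?_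
  simp only [smul_smul]
  rw [integral_smul_const, ← integral_hankelKernel_mul_weightedGaussian ha hs hy.le]
  simp only [mul_comm]

lemma IsHankelPair.ae_eq_hankelTransform (ha : 0 ≤ a) (h : IsHankelPair a f g)
    (hf : MemLp f 2 halfLine) (hg : Integrable g halfLine) :
    f =ᵐ[halfLine] hankelTransform a g :=
  h.ae_eq_left (isHankelPair_hankelTransform ha hg)
    (fun _ hs => integrable_weightedGaussian_smul ha hs hf)
    fun _ hs => integrable_weightedGaussian_smul_hankelTransform ha hg hs

lemma norm_indicator_hankelKernel_le {C : ℝ} (hC : ∀ t, 0 ≤ t → |hankelKernel a t| ≤ C)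
    (B : Set ℝ) {x : ℝ} (hx : 0 < x) :
    ∀ᵐ y ∂halfLine,
      ‖B.indicator (fun y => (hankelKernel a (x * y) : ℂ)) y‖ ≤ ‖B.indicator (fun _ => C) y‖ := by
  filter_upwards [ae_restrict_mem measurableSet_Ioi] with y (hy : 0 < y)
  rw [norm_indicator_eq_indicator_norm, norm_indicator_eq_indicator_norm]
  refine Set.indicator_le_indicator ?_
  rw [Complex.norm_real]
  exact (hC _ (by positivity)).trans (le_abs_self C)

lemma memLp_indicator_hankelKernel (ha : 0 ≤ a) {B : Set ℝ} (hB : MeasurableSet B)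
    (hBf : halfLine B < ⊤) {x : ℝ} (hx : 0 < x) :
    MemLp (B.indicator fun y => (hankelKernel a (x * y) : ℂ)) 2 halfLine := by
  obtain ⟨C, hC⟩ := exists_abs_hankelKernel_le ha
  have continuous_kernel : Continuous fun y => (hankelKernel a (x * y) : ℂ) :=
    Complex.continuous_ofReal.comp ((continuous_hankelKernel ha).comp (continuous_const_mul x))
  exact (memLp_indicator_const 2 hB C (Or.inr hBf.ne)).mono
    (continuous_kernel.aestronglyMeasurable.indicator hB) (norm_indicator_hankelKernel_le hC B hx)

lemma integral_sq_norm_indicator_hankelKernel_le {C : ℝ}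
    (hC : ∀ t, 0 ≤ t → |hankelKernel a t| ≤ C) {B : Set ℝ} (hB : MeasurableSet B)
    (hBf : halfLine B < ⊤) {x : ℝ} (hx : 0 < x) :
    ∫ y, ‖B.indicator (fun y => (hankelKernel a (x * y) : ℂ)) y‖ ^ 2 ∂halfLine ≤
      C ^ 2 * halfLine.real B := by
  have integrable_bound : Integrable (B.indicator fun _ => C ^ 2) halfLine :=
    (integrable_indicator_iff hB).2 (integrableOn_const hBf.ne)
  calc ∫ y, ‖B.indicator (fun y => (hankelKernel a (x * y) : ℂ)) y‖ ^ 2 ∂halfLine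
      ≤ ∫ y, B.indicator (fun _ => C ^ 2) y ∂halfLine := by
        refine integral_mono_of_nonneg (.of_forall fun _ => by positivity) integrable_bound ?_
        filter_upwards [norm_indicator_hankelKernel_le hC B hx] with y hy
        refine (pow_le_pow_left₀ (norm_nonneg _) hy 2).trans_eq ?_
        by_cases hyB : y ∈ B <;> simp [hyB]
    _ = C ^ 2 * halfLine.real B := by
        rw [integral_indicator hB, setIntegral_const, smul_eq_mul, mul_comm]

/-- The Hankel transform cut off to `A` and `B` is a Hilbert-Schmidt operator, because its kernel is
bounded. -/
lemma sum_sq_norm_le_of_isHankelPair (ha : 0 ≤ a) {C : ℝ}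
    (hC : ∀ t, 0 ≤ t → |hankelKernel a t| ≤ C) {A B : Set ℝ} (hA : MeasurableSet A)
    (hB : MeasurableSet B) (hAf : halfLine A < ⊤) (hBf : halfLine B < ⊤) {ι : Type*} [Fintype ι]
    {f g : ι → Lp ℂ 2 halfLine} (hfg : ∀ i, IsHankelPair a (f i) (g i))
    (hfA : ∀ i, ∀ᵐ x ∂halfLine, x ∉ A → f i x = 0)
    (hgB : ∀ i, ∀ᵐ x ∂halfLine, x ∉ B → g i x = 0)
    (hg : ∀ k : Lp ℂ 2 halfLine, ∑ i, ‖⟪g i, k⟫_ℂ‖ ^ 2 ≤ ‖k‖ ^ 2) :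
    ∑ i, ‖f i‖ ^ 2 ≤ C ^ 2 * (halfLine.real A * halfLine.real B) := by
  classical
  let κ (x : ℝ) : ℝ → ℂ :=
    if x ∈ A then B.indicator fun y => (hankelKernel a (x * y) : ℂ) else 0
  have memLp_κ : ∀ᵐ x ∂halfLine, MemLp (κ x) 2 halfLine := by
    filter_upwards [ae_restrict_mem measurableSet_Ioi] with x hx
    by_cases hxA : x ∈ A
    · simpa only [κ, if_pos hxA] using memLp_indicator_hankelKernel ha hB hBf hx
    · simp only [κ, if_neg hxA, MemLp.zero]
  have integral_κ_le : ∀ᵐ x ∂halfLine, ∫ y, ‖κ x y‖ ^ 2 ∂halfLine ≤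
      A.indicator (fun _ => C ^ 2 * halfLine.real B) x := by
    filter_upwards [ae_restrict_mem measurableSet_Ioi] with x hx
    by_cases hxA : x ∈ A
    · simpa only [κ, if_pos hxA, Set.indicator_of_mem hxA] using
        integral_sq_norm_indicator_hankelKernel_le hC hB hBf hx
    · simp [κ, hxA]
  have f_eq_integral (i : ι) : ∀ᵐ x ∂halfLine, f i x = ∫ y, κ x y * g i y ∂halfLine := by
    have integrable_g : Integrable (g i) halfLine :=
      integrable_of_memLp_two_of_support_finite (Lp.memLp (g i)) hBf (hgB i)
    filter_upwards [(hfg i).ae_eq_hankelTransform ha (Lp.memLp _) integrable_g, hfA i]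
      with x hfx hfxA
    by_cases hxA : x ∈ A
    · rw [hfx, hankelTransform]
      refine integral_congr_ae ?_
      filter_upwards [hgB i] with y hgy
      by_cases hyB : y ∈ B
      · simp [κ, hxA, hyB]
      · simp [hgy hyB]
    · simp [κ, hxA, hfxA hxA]
  refine (sum_sq_norm_le_integral_of_ae_eq_integral_mul hg memLp_κ f_eq_integral
    ((integrable_indicator_iff hA).2 (integrableOn_const hAf.ne)) integral_κ_le).trans_eq ?_
  rw [integral_indicator hA, setIntegral_const, smul_eq_mul]
  ring

end HankelPair

/-! ### Pairs supported in sets of finite measure -/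

section HankelSpace

open scoped InnerProductSpace

lemma rank_le_of_forall_orthonormal {𝕜 E : Type*} [RCLike 𝕜] [NormedAddCommGroup E]
    [InnerProductSpace 𝕜 E] {N : ℕ} (h : ∀ (n : ℕ) (v : Fin n → E), Orthonormal 𝕜 v → n ≤ N) :
    Module.rank 𝕜 E ≤ N := by
  refine rank_le fun s hs => ?_
  let U : Submodule 𝕜 E := Submodule.span 𝕜 (Set.range ((↑) : s → E))
  have finrank_U : Module.finrank 𝕜 U = s.card := by
    rw [finrank_span_eq_card hs, Fintype.card_coe]
  have : FiniteDimensional 𝕜 U := FiniteDimensional.span_of_finite 𝕜 (Set.finite_range _)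
  rw [← finrank_U]
  exact h _ _ ((stdOrthonormalBasis 𝕜 U).orthonormal.comp_linearIsometry U.subtypeₗᵢ)

/-- The subspace of `L^p` consisting of the functions that vanish almost everywhere outside `A`. -/
def supportedSubmodule (𝕜 : Type*) {α E : Type*} [MeasurableSpace α] [NormedField 𝕜]
    [NormedAddCommGroup E] [NormedSpace 𝕜 E] (p : ENNReal) (μ : Measure α) (A : Set α) :
    Submodule 𝕜 (Lp E p μ) where
  carrier := {f | ∀ᵐ x ∂μ, x ∉ A → f x = 0}
  zero_mem' := (Lp.coeFn_zero E p μ).mono fun _ hx _ => hx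
  add_mem' {f g} hf hg := by
    filter_upwards [hf, hg, Lp.coeFn_add f g] with x hfx hgx hadd hx
    rw [hadd, Pi.add_apply, hfx hx, hgx hx, add_zero]
  smul_mem' c f hf := by
    filter_upwards [hf, Lp.coeFn_smul c f] with x hfx hsmul hx
    rw [hsmul, Pi.smul_apply, hfx hx, smul_zero]

/-- The Hilbert space `L²(0, ∞) ⊕ L²(0, ∞)`, whose elements are viewed as candidate Hankel
pairs. -/
abbrev LpPair : Type := WithLp 2 (Lp ℂ 2 halfLine × Lp ℂ 2 halfLine)

lemma supportedSubmodule_mono {𝕜 α E : Type*} [MeasurableSpace α] [NormedField 𝕜]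
    [NormedAddCommGroup E] [NormedSpace 𝕜 E] {p : ENNReal} {μ : Measure α} {A A' : Set α}
    (hA : A ⊆ A') : supportedSubmodule 𝕜 (E := E) p μ A ≤ supportedSubmodule 𝕜 p μ A' :=
  fun f (hf : ∀ᵐ x ∂μ, x ∉ A → f x = 0) => hf.mono fun _ hfx hx => hfx fun hxA => hx (hA hxA)

variable {a : ℝ} {A B : Set ℝ}

/-- The space of all Hankel pairs `(f, g)` with `f` supported in `A` and `g` supported in `B`. -/
def hankelSpace (ha : 0 ≤ a) (A B : Set ℝ) : Submodule ℂ LpPair where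
  carrier := {p | IsHankelPair a p.fst p.snd ∧ p.fst ∈ supportedSubmodule ℂ 2 halfLine A ∧
    p.snd ∈ supportedSubmodule ℂ 2 halfLine B}
  zero_mem' := ⟨(IsHankelPair.zero a).congr_ae (Lp.coeFn_zero ..).symm (Lp.coeFn_zero ..).symm,
    zero_mem _, zero_mem _⟩
  add_mem' hp hq := ⟨(hp.1.add ha hq.1 (Lp.memLp _) (Lp.memLp _) (Lp.memLp _)
    (Lp.memLp _)).congr_ae (Lp.coeFn_add ..).symm (Lp.coeFn_add ..).symm,
    add_mem hp.2.1 hq.2.1, add_mem hp.2.2 hq.2.2⟩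
  smul_mem' c _ hp := ⟨(hp.1.const_smul c).congr_ae (Lp.coeFn_smul ..).symm (Lp.coeFn_smul ..).symm,
    Submodule.smul_mem _ c hp.2.1, Submodule.smul_mem _ c hp.2.2⟩

lemma hankelSpace_mono (ha : 0 ≤ a) {A' B' : Set ℝ} (hA : A ⊆ A') (hB : B ⊆ B') :
    hankelSpace ha A B ≤ hankelSpace ha A' B' := fun _ hp =>
  ⟨hp.1, supportedSubmodule_mono hA hp.2.1, supportedSubmodule_mono hB hp.2.2⟩

lemma card_le_of_orthonormal_hankelSpace (ha : 0 ≤ a) {C : ℝ}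
    (hC : ∀ t, 0 ≤ t → |hankelKernel a t| ≤ C) (hA : MeasurableSet A) (hB : MeasurableSet B)
    (hAf : halfLine A < ⊤) (hBf : halfLine B < ⊤) {n : ℕ} {v : Fin n → hankelSpace ha A B}
    (hv : Orthonormal ℂ v) : (n : ℝ) ≤ 2 * (C ^ 2 * (halfLine.real A * halfLine.real B)) := by
  have bessel (k : LpPair) : ∑ i, ‖⟪(v i : LpPair), k⟫_ℂ‖ ^ 2 ≤ ‖k‖ ^ 2 :=
    (hv.comp_linearIsometry (hankelSpace ha A B).subtypeₗᵢ).sum_inner_products_le k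
  have sum_fst_le : ∑ i, ‖(v i : LpPair).fst‖ ^ 2 ≤
      C ^ 2 * (halfLine.real A * halfLine.real B) := by
    refine sum_sq_norm_le_of_isHankelPair ha hC hA hB hAf hBf (fun i => (v i).2.1)
      (fun i => (v i).2.2.1) (fun i => (v i).2.2.2) fun k => ?_
    simpa [WithLp.prod_norm_sq_eq_of_L2] using bessel (WithLp.toLp 2 (0, k))
  have sum_snd_le : ∑ i, ‖(v i : LpPair).snd‖ ^ 2 ≤
      C ^ 2 * (halfLine.real B * halfLine.real A) := by
    refine sum_sq_norm_le_of_isHankelPair ha hC hB hA hBf hAf (fun i => (v i).2.1.symm)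
      (fun i => (v i).2.2.2) (fun i => (v i).2.2.1) fun k => ?_
    simpa [WithLp.prod_norm_sq_eq_of_L2] using bessel (WithLp.toLp 2 (k, 0))
  have sum_eq : ∑ i, (‖(v i : LpPair).fst‖ ^ 2 + ‖(v i : LpPair).snd‖ ^ 2) = n := by
    simp only [← WithLp.prod_norm_sq_eq_of_L2, ← Submodule.coe_norm, hv.1]
    simp
  rw [Finset.sum_add_distrib] at sum_eq
  linarith

lemma exists_forall_rank_hankelSpace_le (ha : 0 ≤ a) {α β : ENNReal} (hα : α < ⊤) (hβ : β < ⊤) :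
    ∃ N : ℕ, ∀ A B, MeasurableSet A → MeasurableSet B → halfLine A < α → halfLine B < β →
      Module.rank ℂ (hankelSpace ha A B) ≤ N := by
  obtain ⟨C, hC⟩ := exists_abs_hankelKernel_le ha
  obtain ⟨N, hN⟩ := exists_nat_ge (2 * (C ^ 2 * (α.toReal * β.toReal)))
  refine ⟨N, fun A B hA hB hAα hBβ => rank_le_of_forall_orthonormal fun n v hv => ?_⟩
  have real_A_le : halfLine.real A ≤ α.toReal := ENNReal.toReal_mono hα.ne hAα.le
  have real_B_le : halfLine.real B ≤ β.toReal := ENNReal.toReal_mono hβ.ne hBβ.le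
  have n_le : (n : ℝ) ≤ N := calc
    (n : ℝ) ≤ 2 * (C ^ 2 * (halfLine.real A * halfLine.real B)) :=
      card_le_of_orthonormal_hankelSpace ha hC hA hB (hAα.trans hα) (hBβ.trans hβ) hv
    _ ≤ 2 * (C ^ 2 * (α.toReal * β.toReal)) := by gcongr
    _ ≤ N := hN
  exact_mod_cast n_le

end HankelSpace

section Dilation

variable {a l : ℝ} {A B : Set ℝ}

lemma halfLine_preimage_mul (hl : 0 < l) (A : Set ℝ) :
    halfLine ((l * ·) ⁻¹' A) = ENNReal.ofReal l⁻¹ * halfLine A := by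
  have preimage_inter : (l * ·) ⁻¹' A ∩ Set.Ioi 0 = (l * ·) ⁻¹' (A ∩ Set.Ioi 0) := by
    ext x
    simp [hl]
  rw [halfLine, Measure.restrict_apply' measurableSet_Ioi,
    Measure.restrict_apply' measurableSet_Ioi, preimage_inter,
    Real.volume_preimage_mul_left hl.ne', abs_of_pos (inv_pos.2 hl)]

lemma ae_halfLine_comp_mul (hl : 0 < l) {P : ℝ → Prop} (h : ∀ᵐ x ∂halfLine, P x) :
    ∀ᵐ x ∂halfLine, P (l * x) := by
  rw [ae_iff] at h ⊢
  have preimage_null := halfLine_preimage_mul hl {x | ¬ P x}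
  rwa [h, mul_zero] at preimage_null

lemma map_mul_halfLine (hl : 0 < l) :
    halfLine.map (l * ·) = ENNReal.ofReal l⁻¹ • halfLine := by
  ext A hA
  rw [Measure.map_apply (measurable_const_mul l) hA, halfLine_preimage_mul hl,
    Measure.smul_apply, smul_eq_mul]

lemma memLp_halfLine_comp_mul (hl : 0 < l) {f : ℝ → ℂ} (hf : MemLp f 2 halfLine) :
    MemLp (fun x => f (l * x)) 2 halfLine := by
  refine MemLp.comp_of_map ?_ (measurable_const_mul l).aemeasurable
  rw [map_mul_halfLine hl]
  exact hf.smul_measure ENNReal.ofReal_ne_top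

/-- The dilation `f ↦ f (l ·)` on `L²(0, ∞)`. -/
noncomputable def dilation (hl : 0 < l) : Lp ℂ 2 halfLine →ₗ[ℂ] Lp ℂ 2 halfLine where
  toFun f := (memLp_halfLine_comp_mul hl (Lp.memLp f)).toLp _
  map_add' f g := by
    rw [← MemLp.toLp_add]
    exact MemLp.toLp_congr _ _ (ae_halfLine_comp_mul hl (Lp.coeFn_add f g))
  map_smul' c f := by
    rw [RingHom.id_apply, ← MemLp.toLp_const_smul]
    exact MemLp.toLp_congr _ _ (ae_halfLine_comp_mul hl (Lp.coeFn_smul c f))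

lemma coeFn_dilation (hl : 0 < l) (f : Lp ℂ 2 halfLine) :
    dilation hl f =ᵐ[halfLine] fun x => f (l * x) :=
  MemLp.coeFn_toLp (memLp_halfLine_comp_mul hl (Lp.memLp f))

lemma dilation_mem_supportedSubmodule (hl : 0 < l) {f : Lp ℂ 2 halfLine}
    (hf : f ∈ supportedSubmodule ℂ 2 halfLine A) :
    dilation hl f ∈ supportedSubmodule ℂ 2 halfLine ((l * ·) ⁻¹' A) := by
  filter_upwards [coeFn_dilation hl f, ae_halfLine_comp_mul hl hf] with x hx hfx hxA
  exact hx.trans (hfx hxA)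

lemma integral_weightedGaussian_smul_comp_mul (hl : 0 < l) (a s : ℝ) (f : ℝ → ℂ) :
    ∫ x, weightedGaussian a s x • f (l * x) ∂halfLine =
      (l ^ (-(a + 1))) • ∫ x, weightedGaussian a (s / l ^ 2) x • f x ∂halfLine := by
  have weightedGaussian_mul {x : ℝ} (hx : 0 < x) :
      weightedGaussian a s x = l ^ (-a) * weightedGaussian a (s / l ^ 2) (l * x) := by
    have rpow_ne_zero := (Real.rpow_pos_of_pos hl a).ne'
    simp only [weightedGaussian]
    rw [Real.mul_rpow hl.le hx.le, Real.rpow_neg hl.le,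
      show -(Real.pi * (s / l ^ 2)) * (l * x) ^ 2 = -(Real.pi * s) * x ^ 2 by field_simp]
    field_simp
  calc ∫ x, weightedGaussian a s x • f (l * x) ∂halfLine
      = ∫ x in Set.Ioi 0,
          l ^ (-a) • weightedGaussian a (s / l ^ 2) (l * x) • f (l * x) := by
        refine setIntegral_congr_fun measurableSet_Ioi fun x hx => ?_
        simp only [smul_smul, ← weightedGaussian_mul hx]
    _ = l⁻¹ • l ^ (-a) • ∫ x, weightedGaussian a (s / l ^ 2) x • f x ∂halfLine := by
        rw [integral_comp_mul_left_Ioi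
          (fun x => l ^ (-a) • weightedGaussian a (s / l ^ 2) x • f x) 0 hl, mul_zero,
          integral_smul, halfLine]
    _ = _ := by
        rw [smul_smul, ← Real.rpow_neg_one, ← Real.rpow_add hl, ← neg_add_rev]

lemma IsHankelPair.comp_mul (hl : 0 < l) {f g : ℝ → ℂ} (h : IsHankelPair a f g) :
    IsHankelPair a (fun x => f (l * x)) (fun x => (l⁻¹ : ℂ) • g (l⁻¹ * x)) := by
  intro s hs
  have factor_eq : l ^ (-(a + 1)) * (s / l ^ 2) ^ (-(a + 1 / 2)) =
      s ^ (-(a + 1 / 2)) * (l⁻¹ * l⁻¹ ^ (-(a + 1))) := by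
    rw [Real.div_rpow hs.le (by positivity), Real.inv_rpow hl.le, ← Real.rpow_natCast l 2,
      ← Real.rpow_mul hl.le, div_eq_mul_inv, ← Real.rpow_neg hl.le, ← Real.rpow_neg hl.le,
      ← Real.rpow_neg_one, mul_left_comm, ← Real.rpow_add hl, ← Real.rpow_add hl]
    push_cast
    ring_nf
  simp only [smul_comm _ (l⁻¹ : ℂ), integral_smul]
  rw [integral_weightedGaussian_smul_comp_mul hl, h (s / l ^ 2) (by positivity),
    integral_weightedGaussian_smul_comp_mul (inv_pos.2 hl),
    show s⁻¹ / l⁻¹ ^ 2 = (s / l ^ 2)⁻¹ by field_simp, ← Complex.ofReal_inv, Complex.coe_smul,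
    smul_smul, smul_smul, smul_smul, factor_eq]
  ring_nf

/-- The dilation of Hankel pairs: dilating `f` by `l` dilates its Hankel transform by `l⁻¹`. -/
noncomputable def pairDilation (hl : 0 < l) : LpPair →ₗ[ℂ] LpPair where
  toFun p := WithLp.toLp 2 (dilation hl p.fst, (l⁻¹ : ℂ) • dilation (inv_pos.2 hl) p.snd)
  map_add' p q := by simp [smul_add, ← WithLp.toLp_add]
  map_smul' c p := by simp [smul_comm c, ← WithLp.toLp_smul]

lemma pairDilation_mem_hankelSpace (ha : 0 ≤ a) (hl : 0 < l) {p : LpPair}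
    (hp : p ∈ hankelSpace ha A B) :
    pairDilation hl p ∈ hankelSpace ha ((l * ·) ⁻¹' A) ((l⁻¹ * ·) ⁻¹' B) := by
  refine ⟨(hp.1.comp_mul hl).congr_ae (coeFn_dilation hl p.fst).symm ?_,
    dilation_mem_supportedSubmodule hl hp.2.1,
    Submodule.smul_mem _ _ (dilation_mem_supportedSubmodule (inv_pos.2 hl) hp.2.2)⟩
  filter_upwards [Lp.coeFn_smul (l⁻¹ : ℂ) (dilation (inv_pos.2 hl) p.snd),
    coeFn_dilation (inv_pos.2 hl) p.snd] with x hsmul hdil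
  rw [← hdil]
  exact hsmul.symm

/-- The set where `f ≠ 0` has finite measure and, up to null sets, agrees with its own dilation. -/
lemma eq_zero_of_dilation_eq_smul (hl : 0 < l) (hl1 : l ≠ 1) {f : Lp ℂ 2 halfLine} {c : ℂ}
    (h : dilation hl f = c • f) (hAf : halfLine A < ⊤)
    (hfA : f ∈ supportedSubmodule ℂ 2 halfLine A) : f = 0 := by
  have comp_mul_eq : ∀ᵐ x ∂halfLine, f (l * x) = c * f x := by
    filter_upwards [coeFn_dilation hl f, Lp.coeFn_smul c f] with x hdil hsmul
    rw [← hdil, h, hsmul, Pi.smul_apply, smul_eq_mul]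
  let Z : Set ℝ := {x | f x ≠ 0}
  suffices Z_null : halfLine Z = 0 from
    Lp.eq_zero_iff_ae_eq_zero.2 (ae_iff.2 Z_null)
  have Z_finite : halfLine Z ≠ ⊤ := by
    refine ne_top_of_le_ne_top hAf.ne (measure_mono_ae ?_)
    filter_upwards [hfA] with x hx hxZ
    exact not_imp_comm.1 hx hxZ
  have measure_preimage : halfLine ((l * ·) ⁻¹' Z) = 0 ∨ halfLine ((l * ·) ⁻¹' Z) = halfLine Z := by
    rcases eq_or_ne c 0 with rfl | hc
    · refine .inl (measure_eq_zero_iff_ae_notMem.2 ?_)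
      filter_upwards [comp_mul_eq] with x hx
      simp [Z, hx]
    · refine .inr (measure_congr ?_)
      filter_upwards [comp_mul_eq] with x hx
      change (f (l * x) ≠ 0) = (f x ≠ 0)
      simp [hx, hc]
  rw [halfLine_preimage_mul hl] at measure_preimage
  rcases measure_preimage with h_zero | h_eq
  · exact (mul_eq_zero.1 h_zero).resolve_left (ENNReal.ofReal_pos.2 (inv_pos.2 hl)).ne'
  · by_contra Z_ne_zero
    rw [ENNReal.mul_eq_right Z_ne_zero Z_finite, ENNReal.ofReal_eq_one, inv_eq_one] at h_eq
    exact hl1 h_eq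

/-- Outer regularity gives an open `U ⊇ A` of measure `< r`, and inner regularity a compact `K ⊆ A`
carrying almost all of `A`; a dilation close to `1` keeps `K` inside `U`. -/
lemma eventually_halfLine_union_preimage_lt (hA : MeasurableSet A) {r : ENNReal}
    (hr : halfLine A < r) :
    ∀ᶠ l in nhds (1 : ℝ), halfLine (A ∪ (l * ·) ⁻¹' A) < r := by
  obtain ⟨U, hAU, hU, hUr⟩ := A.exists_isOpen_lt_of_lt r hr
  obtain ⟨ε, hε, hεr⟩ := ENNReal.lt_iff_exists_add_pos_lt.1 hUr
  obtain ⟨K, hKA, hK, hKε⟩ := hA.exists_isCompact_sdiff_lt (μ := halfLine) (ne_top_of_lt hr)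
    (ε := ε / 2) (ENNReal.div_pos (by exact_mod_cast hε.ne') (by simp)).ne'
  have eventually_mapsTo : ∀ᶠ l in nhds (1 : ℝ), ∀ y ∈ K, l⁻¹ * y ∈ U := by
    refine hK.eventually_forall_of_forall_eventually fun y hy => ?_
    have continuousAt_div : ContinuousAt (fun z : ℝ × ℝ => z.1⁻¹ * z.2) (1, y) :=
      (continuousAt_fst.inv₀ one_ne_zero).mul continuousAt_snd
    refine continuousAt_div.eventually (hU.mem_nhds ?_)
    simpa using hAU (hKA hy)
  filter_upwards [eventually_mapsTo, lt_mem_nhds (show (2⁻¹ : ℝ) < 1 by norm_num)] with l hlK hl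
  have l_pos : 0 < l := lt_trans (by norm_num) hl
  have union_subset : A ∪ (l * ·) ⁻¹' A ⊆ U ∪ (l * ·) ⁻¹' (A \ K) := by
    rintro x (hx | hx)
    · exact .inl (hAU hx)
    · by_cases hxK : l * x ∈ K
      · exact .inl (inv_mul_cancel_left₀ l_pos.ne' x ▸ hlK _ hxK)
      · exact .inr ⟨hx, hxK⟩
  have ofReal_inv_le : ENNReal.ofReal l⁻¹ ≤ 2 :=
    ENNReal.ofReal_le_of_le_toReal (by simpa using (inv_lt_of_inv_lt₀ two_pos hl).le)
  calc halfLine (A ∪ (l * ·) ⁻¹' A)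
      ≤ halfLine U + halfLine ((l * ·) ⁻¹' (A \ K)) :=
        (measure_mono union_subset).trans (measure_union_le _ _)
    _ ≤ halfLine U + 2 * (ε / 2) := by
        rw [halfLine_preimage_mul l_pos]
        gcongr
    _ = halfLine U + ε := by rw [ENNReal.mul_div_cancel (by simp) (by simp)]
    _ < r := hεr

end Dilation

section HankelUncertainty

variable {a : ℝ} {A B : Set ℝ}

lemma hankelSpace_eq_bot_of_pairDilation_mem (ha : 0 ≤ a) (hAf : halfLine A < ⊤)
    (hBf : halfLine B < ⊤) [FiniteDimensional ℂ (hankelSpace ha A B)] {l : ℝ} (hl : 0 < l)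
    (hl1 : l ≠ 1) (hinv : ∀ p ∈ hankelSpace ha A B, pairDilation hl p ∈ hankelSpace ha A B) :
    hankelSpace ha A B = ⊥ := by
  by_contra ne_bot
  have : Nontrivial (hankelSpace ha A B) := Submodule.nontrivial_iff_ne_bot.2 ne_bot
  obtain ⟨c, hc⟩ := Module.End.exists_eigenvalue ((pairDilation hl).restrict hinv)
  obtain ⟨⟨p, hp⟩, eigenvector⟩ := hc.exists_hasEigenvector
  have dilate_p : pairDilation hl p = c • p := congrArg Subtype.val eigenvector.apply_eq_smul
  have dilate_fst : dilation hl p.fst = c • p.fst := congrArg WithLp.fst dilate_p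
  have dilate_snd : dilation (inv_pos.2 hl) p.snd = (l * c) • p.snd := by
    have smul_dilate_snd : (l⁻¹ : ℂ) • dilation (inv_pos.2 hl) p.snd = c • p.snd :=
      congrArg WithLp.snd dilate_p
    rw [mul_smul, ← smul_dilate_snd, smul_inv_smul₀ (by exact_mod_cast hl.ne')]
  have fst_eq_zero : p.fst = 0 := eq_zero_of_dilation_eq_smul hl hl1 dilate_fst hAf hp.2.1
  have snd_eq_zero : p.snd = 0 :=
    eq_zero_of_dilation_eq_smul (inv_pos.2 hl) (inv_ne_one.2 hl1) dilate_snd hBf hp.2.2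
  exact eigenvector.2 (Subtype.ext (WithLp.ofLp_injective 2 (Prod.ext fst_eq_zero snd_eq_zero)))

/-- If the dimension of `hankelSpace` is maximal at `(A, B)` among the pairs of sets of measure less
than `α` and `β`, then enlarging `A` and `B` by a small dilation does not change the space, which is
thus invariant under that dilation. -/
lemma hankelSpace_eq_bot_of_finrank_maximal (ha : 0 ≤ a) (hA : MeasurableSet A)
    (hB : MeasurableSet B) {α β : ENNReal} (hAα : halfLine A < α) (hBβ : halfLine B < β)
    (hfin : ∀ A' B', MeasurableSet A' → MeasurableSet B' → halfLine A' < α → halfLine B' < β →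
      FiniteDimensional ℂ (hankelSpace ha A' B'))
    (hmax : ∀ A' B', MeasurableSet A' → MeasurableSet B' → halfLine A' < α → halfLine B' < β →
      Module.finrank ℂ (hankelSpace ha A' B') ≤ Module.finrank ℂ (hankelSpace ha A B)) :
    hankelSpace ha A B = ⊥ := by
  have tendsto_inv : Filter.Tendsto (fun l : ℝ => l⁻¹) (nhds 1) (nhds 1) := by
    simpa using (continuousAt_inv₀ (one_ne_zero (α := ℝ))).tendsto
  obtain ⟨l, ⟨hlA, hlB⟩, hl1 : 1 < l⟩ :=
    ((((eventually_halfLine_union_preimage_lt hA hAα).and (tendsto_inv.eventually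
      (eventually_halfLine_union_preimage_lt hB hBβ))).filter_mono nhdsWithin_le_nhds).and
      (self_mem_nhdsWithin (s := Set.Ioi (1 : ℝ)))).exists
  have hl : 0 < l := one_pos.trans hl1
  let A' := A ∪ (l * ·) ⁻¹' A
  let B' := B ∪ (l⁻¹ * ·) ⁻¹' B
  have hA' : MeasurableSet A' := hA.union (measurable_const_mul l hA)
  have hB' : MeasurableSet B' := hB.union (measurable_const_mul l⁻¹ hB)
  have := hfin A' B' hA' hB' hlA hlB
  have := hfin A B hA hB hAα hBβ
  have hankelSpace_eq : hankelSpace ha A B = hankelSpace ha A' B' :=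
    Submodule.eq_of_le_of_finrank_le
      (hankelSpace_mono ha Set.subset_union_left Set.subset_union_left)
      (hmax A' B' hA' hB' hlA hlB)
  refine hankelSpace_eq_bot_of_pairDilation_mem ha (hAα.trans_le le_top) (hBβ.trans_le le_top) hl
    hl1.ne' fun p hp => ?_
  rw [hankelSpace_eq]
  exact hankelSpace_mono ha Set.subset_union_right Set.subset_union_right
    (pairDilation_mem_hankelSpace ha hl hp)

lemma hankelSpace_eq_bot_of_measurableSet (ha : 0 ≤ a) (hA : MeasurableSet A) (hB : MeasurableSet B)
    (hAf : halfLine A < ⊤) (hBf : halfLine B < ⊤) : hankelSpace ha A B = ⊥ := by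
  let α := halfLine A + 1
  let β := halfLine B + 1
  have hAα : halfLine A < α := ENNReal.lt_add_right hAf.ne one_ne_zero
  have hBβ : halfLine B < β := ENNReal.lt_add_right hBf.ne one_ne_zero
  obtain ⟨N, hN⟩ := exists_forall_rank_hankelSpace_le ha (α := α) (β := β)
    (ENNReal.add_lt_top.2 ⟨hAf, ENNReal.one_lt_top⟩)
    (ENNReal.add_lt_top.2 ⟨hBf, ENNReal.one_lt_top⟩)
  have finite_dim (A' B' : Set ℝ) (hA' : MeasurableSet A') (hB' : MeasurableSet B')
      (hAα' : halfLine A' < α) (hBβ' : halfLine B' < β) :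
      FiniteDimensional ℂ (hankelSpace ha A' B') :=
    Module.rank_lt_aleph0_iff.1 ((hN A' B' hA' hB' hAα' hBβ').trans_lt Cardinal.natCast_lt_aleph0)
  let dims : Set ℕ := {n | ∃ A' B', MeasurableSet A' ∧ MeasurableSet B' ∧ halfLine A' < α ∧
    halfLine B' < β ∧ Module.finrank ℂ (hankelSpace ha A' B') = n}
  have mem_dims {A' B' : Set ℝ} (hA' : MeasurableSet A') (hB' : MeasurableSet B')
      (hAα' : halfLine A' < α) (hBβ' : halfLine B' < β) :
      Module.finrank ℂ (hankelSpace ha A' B') ∈ dims := ⟨A', B', hA', hB', hAα', hBβ', rfl⟩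
  have bddAbove_dims : BddAbove dims := by
    refine ⟨N, ?_⟩
    rintro _ ⟨A', B', hA', hB', hAα', hBβ', rfl⟩
    exact Module.finrank_le_of_rank_le (hN A' B' hA' hB' hAα' hBβ')
  obtain ⟨_, ⟨A₀, B₀, hA₀, hB₀, hAα₀, hBβ₀, rfl⟩, isMax⟩ :=
    bddAbove_dims.exists_isGreatest_of_nonempty ⟨_, mem_dims hA hB hAα hBβ⟩
  have eq_bot₀ : hankelSpace ha A₀ B₀ = ⊥ :=
    hankelSpace_eq_bot_of_finrank_maximal ha hA₀ hB₀ hAα₀ hBβ₀ finite_dim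
      fun _ _ hA' hB' hAα' hBβ' => isMax (mem_dims hA' hB' hAα' hBβ')
  have finrank_le := isMax (mem_dims hA hB hAα hBβ)
  rw [eq_bot₀, finrank_bot, Nat.le_zero] at finrank_le
  have := finite_dim A B hA hB hAα hBβ
  exact Submodule.finrank_eq_zero.1 finrank_le

lemma hankelSpace_eq_bot (ha : 0 ≤ a) (hAf : halfLine A < ⊤) (hBf : halfLine B < ⊤) :
    hankelSpace ha A B = ⊥ := by
  rw [eq_bot_iff, ← hankelSpace_eq_bot_of_measurableSet ha (measurableSet_toMeasurable halfLine A)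
    (measurableSet_toMeasurable halfLine B) (by rwa [measure_toMeasurable])
    (by rwa [measure_toMeasurable])]
  exact hankelSpace_mono ha (subset_toMeasurable halfLine A) (subset_toMeasurable halfLine B)

theorem IsHankelPair.ae_eq_zero (ha : 0 ≤ a) {f g : ℝ → ℂ} (h : IsHankelPair a f g)
    (hf : MemLp f 2 halfLine) (hg : MemLp g 2 halfLine) (hAf : halfLine A < ⊤)
    (hBf : halfLine B < ⊤) (hfA : ∀ᵐ x ∂halfLine, x ∉ A → f x = 0)
    (hgB : ∀ᵐ x ∂halfLine, x ∉ B → g x = 0) : f =ᵐ[halfLine] 0 := by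
  have pair_mem : WithLp.toLp 2 (hf.toLp f, hg.toLp g) ∈ hankelSpace ha A B := by
    refine ⟨h.congr_ae hf.coeFn_toLp.symm hg.coeFn_toLp.symm, ?_, ?_⟩
    · filter_upwards [hf.coeFn_toLp, hfA] with x hx hxA hxn using hx.trans (hxA hxn)
    · filter_upwards [hg.coeFn_toLp, hgB] with x hx hxB hxn using hx.trans (hxB hxn)
  rw [hankelSpace_eq_bot ha hAf hBf, Submodule.mem_bot] at pair_mem
  have toLp_eq_zero : hf.toLp f = 0 := congrArg WithLp.fst pair_mem
  exact hf.coeFn_toLp.symm.trans (Lp.eq_zero_iff_ae_eq_zero.1 toLp_eq_zero)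

end HankelUncertainty

/-! ### Gaussian moments and the Fourier transform -/

section PowerSeries

lemma tendsto_inv_pow_mul_of_hasSum {p : ℕ → ℂ} {P : ℝ → ℂ}
    (h : ∀ z : ℝ, HasSum (fun k => p k * (z : ℂ) ^ k) (P z)) {k : ℕ} (hk : ∀ j < k, p j = 0) :
    Filter.Tendsto (fun z : ℝ => ((z : ℂ) ^ k)⁻¹ * P z) (nhdsWithin 0 {0}ᶜ) (nhds (p k)) := by
  have summable_shift : Summable fun j => ‖p (j + k)‖ := by
    have summable_one := (h 1).summable.norm
    simp only [Complex.ofReal_one, one_pow, mul_one] at summable_one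
    exact (summable_nat_add_iff k).2 summable_one
  have tendsto_shift : Filter.Tendsto (fun z : ℝ => ∑' j, p (j + k) * (z : ℂ) ^ j)
      (nhdsWithin 0 {0}ᶜ) (nhds (∑' j, p (j + k) * ((0 : ℝ) : ℂ) ^ j)) := by
    refine tendsto_tsum_of_dominated_convergence summable_shift (fun j => ?_) ?_
    · have continuous_term : Continuous fun z : ℝ => p (j + k) * (z : ℂ) ^ j := by fun_prop
      exact (continuous_term.tendsto 0).mono_left nhdsWithin_le_nhds
    · filter_upwards [nhdsWithin_le_nhds (Metric.ball_mem_nhds (0 : ℝ) one_pos)] with z hz j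
      rw [norm_mul, norm_pow, Complex.norm_real]
      exact mul_le_of_le_one_right (norm_nonneg _)
        (pow_le_one₀ (norm_nonneg _) (mem_ball_zero_iff.1 hz).le)
  have tsum_zero : ∑' j, p (j + k) * ((0 : ℝ) : ℂ) ^ j = p k := by
    rw [tsum_eq_single 0 (fun j hj => by simp [hj])]
    simp
  rw [tsum_zero] at tendsto_shift
  refine tendsto_shift.congr' ?_
  filter_upwards [self_mem_nhdsWithin] with z (hz : z ≠ 0)
  have pow_ne_zero : (z : ℂ) ^ k ≠ 0 := pow_ne_zero _ (by exact_mod_cast hz)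
  have hasSum_shift := (hasSum_nat_add_iff' k).2 (h z)
  rw [Finset.sum_eq_zero fun j hj => by rw [hk j (Finset.mem_range.1 hj), zero_mul],
    sub_zero] at hasSum_shift
  rw [← hasSum_shift.tsum_eq, ← tsum_mul_left]
  refine tsum_congr fun j => ?_
  rw [pow_add]
  field_simp

lemma coeff_eq_mul_coeff_of_hasSum {p q : ℕ → ℂ} {P Q u : ℝ → ℂ}
    (hP : ∀ z : ℝ, HasSum (fun k => p k * (z : ℂ) ^ k) (P z))
    (hQ : ∀ z : ℝ, HasSum (fun k => q k * (z : ℂ) ^ k) (Q z)) (hu : ContinuousAt u 0)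
    (hPQ : ∀ z, P z = u z * Q z) {k : ℕ} (hp : ∀ j < k, p j = 0) (hq : ∀ j < k, q j = 0) :
    p k = u 0 * q k := by
  have tendsto_P := tendsto_inv_pow_mul_of_hasSum hP hp
  have tendsto_uQ :=
    (hu.tendsto.mono_left nhdsWithin_le_nhds).mul (tendsto_inv_pow_mul_of_hasSum hQ hq)
  exact tendsto_nhds_unique tendsto_P (tendsto_uQ.congr fun z => by rw [hPQ z, mul_left_comm])

end PowerSeries

section FourierGaussian

open scoped InnerProductSpace ComplexConjugate

variable {V : Type*} [NormedAddCommGroup V] [InnerProductSpace ℝ V]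

/-- The Gaussian `exp (-π s |v|²)` modulated by the character of frequency `x`. -/
noncomputable def modulatedGaussian (s : ℝ) (x v : V) : ℂ :=
  Complex.exp (-(Real.pi * s : ℝ) * ‖v‖ ^ 2 + 2 * Real.pi * Complex.I * ⟪x, v⟫_ℝ)

lemma conj_modulatedGaussian (s : ℝ) (x v : V) : conj (modulatedGaussian s x v) =
    Real.exp (-(Real.pi * s) * ‖v‖ ^ 2) • Complex.exp (-(2 * Real.pi * Complex.I) * ⟪x, v⟫_ℝ) := by
  rw [modulatedGaussian, ← Complex.exp_conj, Complex.real_smul, Complex.ofReal_exp,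
    ← Complex.exp_add]
  have conj_two : conj (2 : ℂ) = 2 := Complex.conj_ofNat 2
  simp [conj_two]

lemma norm_pow_div_factorial_mul_exp_smul_le (F : V → ℂ) (e : V) (s : ℝ) (c : ℂ) (k : ℕ) (v : V) :
    ‖c ^ k / k.factorial *
        (Real.exp (-(Real.pi * s) * ‖v‖ ^ 2) • ((⟪e, v⟫_ℝ : ℂ) ^ k * F v))‖ ≤
      (‖c‖ * ‖e‖ * ‖v‖) ^ k / k.factorial * (Real.exp (-(Real.pi * s) * ‖v‖ ^ 2) * ‖F v‖) := by
  rw [norm_mul, norm_smul, norm_mul, norm_div, norm_pow, norm_pow, Complex.norm_real,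
    Real.norm_eq_abs, Real.norm_eq_abs, Real.abs_exp, Complex.norm_natCast]
  calc ‖c‖ ^ k / k.factorial *
        (Real.exp (-(Real.pi * s) * ‖v‖ ^ 2) * (|⟪e, v⟫_ℝ| ^ k * ‖F v‖))
      ≤ ‖c‖ ^ k / k.factorial *
        (Real.exp (-(Real.pi * s) * ‖v‖ ^ 2) * ((‖e‖ * ‖v‖) ^ k * ‖F v‖)) := by
        gcongr
        exact abs_real_inner_le_norm e v
    _ = _ := by rw [mul_assoc ‖c‖, mul_pow ‖c‖]; ring

variable [FiniteDimensional ℝ V] [MeasurableSpace V] [BorelSpace V]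

lemma fourier_toLp_ae_eq {h : V → ℂ} (h1 : Integrable h) (h2 : MemLp h 2) :
    (𝓕 (h2.toLp h) : Lp ℂ 2 (volume : Measure V)) =ᵐ[volume] 𝓕 h := by
  have continuous_fourier : Continuous (𝓕 h) :=
    VectorFourier.fourierIntegral_continuous Real.continuous_fourierChar
      (by exact continuous_inner) h1
  refine ae_eq_of_integral_contDiff_smul_eq ((Lp.memLp _).locallyIntegrable (by norm_num))
    continuous_fourier.locallyIntegrable fun g g_smooth g_compact => ?_
  have g_compact' : HasCompactSupport fun x => (g x : ℂ) := g_compact.comp_left Complex.ofReal_zero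
  let φ : SchwartzMap V ℂ := g_compact'.toSchwartzMap (Complex.ofRealCLM.contDiff.comp g_smooth)
  have smul_eq (k : V → ℂ) : ∫ x, g x • k x = ∫ x, φ x • k x :=
    integral_congr_ae (.of_forall fun x => (Complex.coe_smul (g x) (k x)).symm)
  calc ∫ x, g x • (𝓕 (h2.toLp h) : Lp ℂ 2 (volume : Measure V)) x
      = ∫ x, (𝓕 φ) x • (h2.toLp h) x := by
        have fourier_distribution := congrArg (fun T : TemperedDistribution V ℂ => T φ)
          (Lp.fourier_toTemperedDistribution_eq (h2.toLp h))
        simp only [TemperedDistribution.fourier_apply,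
          Lp.toTemperedDistribution_apply] at fourier_distribution
        rw [smul_eq, fourier_distribution]
    _ = ∫ x, 𝓕 (φ : V → ℂ) x • h x := by
        refine integral_congr_ae ?_
        filter_upwards [h2.coeFn_toLp] with x hx
        rw [hx]
        rfl
    _ = ∫ x, g x • 𝓕 h x := by
        rw [smul_eq]
        simpa using! VectorFourier.integral_fourierIntegral_smul_eq_flip (L := innerₗ V)
          Real.continuous_fourierChar continuous_inner φ.integrable h1

lemma integral_conj_mul_eq_integral_conj_fourier_mul {h : V → ℂ} (h1 : Integrable h)
    (h2 : MemLp h 2) (F : Lp ℂ 2 (volume : Measure V)) :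
    ∫ v, conj (h v) * F v = ∫ w, conj (𝓕 h w) * (𝓕 F : Lp ℂ 2 (volume : Measure V)) w := by
  have plancherel := (Lp.inner_fourier_eq (h2.toLp h) F).symm
  rw [L2.inner_def, L2.inner_def] at plancherel
  convert plancherel using 1
  · refine integral_congr_ae ?_
    filter_upwards [h2.coeFn_toLp] with v hv
    rw [hv, RCLike.inner_apply, mul_comm]
  · refine integral_congr_ae ?_
    filter_upwards [fourier_toLp_ae_eq h1 h2] with w hw
    rw [hw, RCLike.inner_apply, mul_comm]

lemma integrable_exp_neg_mul_sq_norm {b : ℝ} (hb : 0 < b) :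
    Integrable (fun v : V => Real.exp (-b * ‖v‖ ^ 2)) := by
  refine Integrable.of_integral_ne_zero ?_
  rw [GaussianFourier.integral_rexp_neg_mul_sq_norm hb]
  positivity

lemma memLp_exp_neg_mul_sq_norm_add {b : ℝ} (hb : 0 < b) (c : ℝ) :
    MemLp (fun v : V => Real.exp (-b * ‖v‖ ^ 2 + c * ‖v‖)) 2 := by
  have continuous_exp : Continuous fun v : V => Real.exp (-b * ‖v‖ ^ 2 + c * ‖v‖) := by fun_prop
  rw [memLp_two_iff_integrable_sq continuous_exp.aestronglyMeasurable]
  refine ((integrable_exp_neg_mul_sq_norm hb).const_mul (Real.exp (c ^ 2 / b))).mono'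
    (continuous_exp.pow 2).aestronglyMeasurable (.of_forall fun v => ?_)
  have complete_square : b * ‖v‖ ^ 2 + c ^ 2 / b - 2 * c * ‖v‖ = (b * ‖v‖ - c) ^ 2 / b := by
    field_simp
    ring
  have sq_div_nonneg : 0 ≤ (b * ‖v‖ - c) ^ 2 / b := by positivity
  rw [Real.norm_eq_abs, abs_of_nonneg (by positivity), ← Real.exp_nat_mul, ← Real.exp_add,
    Real.exp_le_exp]
  push_cast
  linarith

lemma integrable_modulatedGaussian {s : ℝ} (hs : 0 < s) (x : V) :
    Integrable (modulatedGaussian s x) :=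
  GaussianFourier.integrable_cexp_neg_mul_sq_norm_add (by simp [Real.pi_pos, hs]) _ x

lemma memLp_modulatedGaussian {s : ℝ} (hs : 0 < s) (x : V) : MemLp (modulatedGaussian s x) 2 := by
  have memLp_gaussian := memLp_exp_neg_mul_sq_norm_add (V := V) (mul_pos Real.pi_pos hs) 0
  refine memLp_gaussian.congr_norm (integrable_modulatedGaussian hs x).1 (.of_forall fun v => ?_)
  rw [modulatedGaussian, Complex.norm_exp, Real.norm_eq_abs, Real.abs_exp]
  simp [← Complex.ofReal_pow]

lemma fourier_modulatedGaussian {s : ℝ} (hs : 0 < s) (x w : V) :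
    𝓕 (modulatedGaussian s x) w = ((s ^ (-(Module.finrank ℝ V / 2 : ℝ)) *
      Real.exp (-(Real.pi * s⁻¹) * ‖x - w‖ ^ 2) : ℝ) : ℂ) := by
  have b_pos : 0 < ((Real.pi * s : ℝ) : ℂ).re := mul_pos Real.pi_pos hs
  have pi_ne_zero : (Real.pi : ℂ) ≠ 0 := by exact_mod_cast Real.pi_ne_zero
  have s_ne_zero : (s : ℂ) ≠ 0 := by exact_mod_cast hs.ne'
  have factor_eq : ((Real.pi : ℂ) / (Real.pi * s : ℝ)) ^ (Module.finrank ℝ V / 2 : ℂ) =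
      ((s ^ (-(Module.finrank ℝ V / 2 : ℝ)) : ℝ) : ℂ) := by
    rw [show (Real.pi : ℂ) / (Real.pi * s : ℝ) = ((s⁻¹ : ℝ) : ℂ) by push_cast; field_simp,
      show (Module.finrank ℝ V / 2 : ℂ) = ((Module.finrank ℝ V / 2 : ℝ) : ℂ) by push_cast; rfl,
      ← Complex.ofReal_cpow (by positivity), Real.inv_rpow hs.le, Real.rpow_neg hs.le]
  have exponent_eq : -(Real.pi : ℂ) ^ 2 * ‖x - w‖ ^ 2 / (Real.pi * s : ℝ) =
      ((-(Real.pi * s⁻¹) * ‖x - w‖ ^ 2 : ℝ) : ℂ) := by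
    push_cast
    field_simp
  unfold modulatedGaussian
  rw [fourier_gaussian_innerProductSpace' b_pos, factor_eq, exponent_eq, ← Complex.ofReal_exp,
    Complex.ofReal_mul]

/-- The Gaussian moment `∫ ⟨e, v⟩ ^ k exp (-π s |v|²) F(v) dv`. It sees `F` only
through its averages over spheres against `⟨e, ·⟩ ^ k`. -/
noncomputable def gaussianMoment (F : V → ℂ) (e : V) (k : ℕ) (s : ℝ) : ℂ :=
  ∫ v, Real.exp (-(Real.pi * s) * ‖v‖ ^ 2) • ((⟪e, v⟫_ℝ : ℂ) ^ k * F v)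

/-- The exponential generating function, in the variable `c`, of the Gaussian moments of `F`. -/
noncomputable def gaussianGenerating (F : V → ℂ) (e : V) (s : ℝ) (c : ℂ) : ℂ :=
  ∫ v, Real.exp (-(Real.pi * s) * ‖v‖ ^ 2) • (Complex.exp (c * ⟪e, v⟫_ℝ) * F v)

lemma hasSum_gaussianMoment {F : V → ℂ} (hF : MemLp F 2) (e : V) {s : ℝ} (hs : 0 < s) (c : ℂ) :
    HasSum (fun k : ℕ => c ^ k / k.factorial * gaussianMoment F e k s)
      (gaussianGenerating F e s c) := by
  have hasSum_bound (v : V) : HasSum (fun k : ℕ => (‖c‖ * ‖e‖ * ‖v‖) ^ k / k.factorial *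
      (Real.exp (-(Real.pi * s) * ‖v‖ ^ 2) * ‖F v‖))
      (Real.exp (-(Real.pi * s) * ‖v‖ ^ 2 + ‖c‖ * ‖e‖ * ‖v‖) * ‖F v‖) := by
    rw [add_comm, Real.exp_add, mul_assoc (Real.exp _), Real.exp_eq_exp_ℝ]
    exact (NormedSpace.expSeries_div_hasSum_exp (𝔸 := ℝ) _).mul_right _
  have hasSum_term (v : V) : HasSum (fun k : ℕ => c ^ k / k.factorial *
      (Real.exp (-(Real.pi * s) * ‖v‖ ^ 2) • ((⟪e, v⟫_ℝ : ℂ) ^ k * F v)))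
      (Real.exp (-(Real.pi * s) * ‖v‖ ^ 2) • (Complex.exp (c * ⟪e, v⟫_ℝ) * F v)) := by
    rw [Complex.exp_eq_exp_ℂ]
    convert! ((NormedSpace.expSeries_div_hasSum_exp (c * (⟪e, v⟫_ℝ : ℂ))).mul_right
      (F v)).const_smul (Real.exp (-(Real.pi * s) * ‖v‖ ^ 2)) using 2 with k
    rw [mul_pow, mul_smul_comm]
    ring_nf
  have hasSum_integral := hasSum_integral_of_dominated_convergence (μ := (volume : Measure V))
    (fun (k : ℕ) v => (‖c‖ * ‖e‖ * ‖v‖) ^ k / k.factorial *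
      (Real.exp (-(Real.pi * s) * ‖v‖ ^ 2) * ‖F v‖)) ?_
    (fun k => .of_forall fun v => norm_pow_div_factorial_mul_exp_smul_le F e s c k v)
    (.of_forall fun v => (hasSum_bound v).summable) ?_ (.of_forall hasSum_term)
  · simpa only [integral_const_mul, gaussianMoment, gaussianGenerating] using! hasSum_integral
  · intro k
    have continuous_gaussian : Continuous fun v : V => Real.exp (-(Real.pi * s) * ‖v‖ ^ 2) := by
      fun_prop
    have continuous_inner_pow : Continuous fun v : V => (⟪e, v⟫_ℝ : ℂ) ^ k := by fun_prop
    exact (continuous_gaussian.aestronglyMeasurable.smul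
      (continuous_inner_pow.aestronglyMeasurable.mul hF.1)).const_mul _
  · simp only [(hasSum_bound _).tsum_eq]
    exact memLp_one_iff_integrable.1
      (hF.norm.mul (memLp_exp_neg_mul_sq_norm_add (mul_pos Real.pi_pos hs) _))

lemma hasSum_gaussianMoment_mul_pow {F : V → ℂ} (hF : MemLp F 2) (e : V) {s : ℝ} (hs : 0 < s)
    (c : ℂ) (z : ℝ) :
    HasSum (fun k : ℕ => c ^ k / k.factorial * gaussianMoment F e k s * (z : ℂ) ^ k)
      (gaussianGenerating F e s (c * z)) := by
  convert! hasSum_gaussianMoment hF e hs (c * z) using 2 with k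
  rw [mul_pow]
  ring

lemma gaussianGenerating_fourier (F : Lp ℂ 2 (volume : Measure V)) (e : V) {s : ℝ} (hs : 0 < s)
    (z : ℝ) :
    gaussianGenerating F e s (-(2 * Real.pi * Complex.I) * z) =
      ((s ^ (-(Module.finrank ℝ V / 2 : ℝ)) *
        Real.exp (-(Real.pi * s⁻¹) * (z ^ 2 * ‖e‖ ^ 2)) : ℝ) : ℂ) *
      gaussianGenerating (𝓕 F : Lp ℂ 2 (volume : Measure V)) e s⁻¹ (2 * Real.pi * s⁻¹ * z) := by
  have exp_sq_norm_sub (w : V) : (Real.exp (-(Real.pi * s⁻¹) * ‖z • e - w‖ ^ 2) : ℂ) =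
      Real.exp (-(Real.pi * s⁻¹) * (z ^ 2 * ‖e‖ ^ 2)) *
        (Real.exp (-(Real.pi * s⁻¹) * ‖w‖ ^ 2) *
          Complex.exp (2 * Real.pi * s⁻¹ * z * ⟪e, w⟫_ℝ)) := by
    have sq_norm_sub : ‖z • e - w‖ ^ 2 = z ^ 2 * ‖e‖ ^ 2 - 2 * z * ⟪e, w⟫_ℝ + ‖w‖ ^ 2 := by
      rw [norm_sub_sq_real, norm_smul, real_inner_smul_left, mul_pow, Real.norm_eq_abs, sq_abs]
      ring
    rw [sq_norm_sub]
    push_cast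
    rw [← Complex.exp_add, ← Complex.exp_add]
    ring_nf
  calc gaussianGenerating F e s (-(2 * Real.pi * Complex.I) * z)
      = ∫ v, conj (modulatedGaussian s (z • e) v) * F v := by
        refine integral_congr_ae (.of_forall fun v => ?_)
        simp only [conj_modulatedGaussian, real_inner_smul_left, smul_mul_assoc]
        push_cast
        rw [mul_assoc (-(2 * Real.pi * Complex.I))]
    _ = ∫ w, conj (𝓕 (modulatedGaussian s (z • e)) w) *
          (𝓕 F : Lp ℂ 2 (volume : Measure V)) w :=
        integral_conj_mul_eq_integral_conj_fourier_mul (integrable_modulatedGaussian hs _)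
          (memLp_modulatedGaussian hs _) F
    _ = _ := by
        rw [gaussianGenerating, ← integral_const_mul]
        refine integral_congr_ae (.of_forall fun w => ?_)
        simp only [fourier_modulatedGaussian hs, Complex.conj_ofReal, Complex.real_smul]
        rw [Complex.ofReal_mul, exp_sq_norm_sub, Complex.ofReal_mul]
        push_cast
        ring

/-- The factor `exp (-π z² |e|² / s)` relating the two generating functions mixes moments of
different orders; it does not affect the lowest one. -/
lemma gaussianMoment_fourier (F : Lp ℂ 2 (volume : Measure V)) (e : V) {k : ℕ}
    (hF : ∀ j < k, ∀ s, 0 < s → gaussianMoment F e j s = 0)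
    (hF' : ∀ j < k, ∀ s, 0 < s →
      gaussianMoment (𝓕 F : Lp ℂ 2 (volume : Measure V)) e j s = 0) {s : ℝ} (hs : 0 < s) :
    gaussianMoment F e k s = s ^ (-(k + Module.finrank ℝ V / 2 : ℝ)) •
      (Complex.I ^ k * gaussianMoment (𝓕 F : Lp ℂ 2 (volume : Measure V)) e k s⁻¹) := by
  have hs' : 0 < s⁻¹ := inv_pos.2 hs
  let G : Lp ℂ 2 (volume : Measure V) := 𝓕 F
  let d : ℝ := Module.finrank ℝ V / 2
  have coeff_eq : (-(2 * Real.pi * Complex.I)) ^ k / k.factorial * gaussianMoment F e k s =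
      ((s ^ (-d) * Real.exp (-(Real.pi * s⁻¹) * (0 ^ 2 * ‖e‖ ^ 2)) : ℝ) : ℂ) *
        ((2 * Real.pi * s⁻¹) ^ k / k.factorial * gaussianMoment G e k s⁻¹) :=
    coeff_eq_mul_coeff_of_hasSum
      (hasSum_gaussianMoment_mul_pow (Lp.memLp F) e hs _)
      (hasSum_gaussianMoment_mul_pow (Lp.memLp G) e hs' _)
      (u := fun z => ((s ^ (-d) * Real.exp (-(Real.pi * s⁻¹) * (z ^ 2 * ‖e‖ ^ 2)) : ℝ) : ℂ))
      (Continuous.continuousAt (by fun_prop)) (gaussianGenerating_fourier F e hs)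
      (fun j hj => by rw [hF j hj s hs, mul_zero]) (fun j hj => by rw [hF' j hj s⁻¹ hs', mul_zero])
  have rpow_eq : ((s ^ (-(k + d)) : ℝ) : ℂ) = ((s ^ (-d) : ℝ) : ℂ) * (s : ℂ)⁻¹ ^ k := by
    rw [neg_add_rev, Real.rpow_add hs, Real.rpow_neg hs.le (k : ℝ), Real.rpow_natCast]
    push_cast
    rw [inv_pow]
  have I_pow : (-Complex.I) ^ k * Complex.I ^ k = 1 := by
    rw [← mul_pow, neg_mul, Complex.I_mul_I, neg_neg, one_pow]
  have factorial_ne_zero : (k.factorial : ℂ) ≠ 0 := by exact_mod_cast k.factorial_ne_zero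
  have two_pi_ne_zero : (2 * Real.pi : ℂ) ^ k ≠ 0 := pow_ne_zero k (by simp [Real.pi_ne_zero])
  rw [show -(2 * Real.pi * Complex.I) = 2 * Real.pi * -Complex.I by ring, mul_pow _ (-Complex.I),
    Complex.ofReal_inv, mul_pow _ (s⁻¹ : ℂ), zero_pow two_ne_zero, zero_mul, mul_zero,
    Real.exp_zero, mul_one] at coeff_eq
  have moment_eq : (-Complex.I) ^ k * gaussianMoment F e k s =
      ((s ^ (-d) : ℝ) : ℂ) * ((s : ℂ)⁻¹ ^ k * gaussianMoment G e k s⁻¹) := by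
    refine mul_left_cancel₀ (div_ne_zero two_pi_ne_zero factorial_ne_zero) ?_
    linear_combination coeff_eq
  rw [Complex.real_smul, rpow_eq]
  linear_combination Complex.I ^ k * moment_eq - gaussianMoment F e k s * I_pow

end FourierGaussian

/-! ### Polar coordinates -/

section RadialMeasure

/-- The measure `r ^ n dr` on the half line, the radial factor of Lebesgue measure in dimension
`n + 1`. -/
noncomputable def radialMeasure (n : ℕ) : Measure ℝ :=
  halfLine.withDensity fun r => ENNReal.ofReal (r ^ n)

instance (n : ℕ) : SFinite (radialMeasure n) := by
  unfold radialMeasure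
  infer_instance

lemma halfLine_absolutelyContinuous_radialMeasure (n : ℕ) : halfLine ≪ radialMeasure n := by
  refine withDensity_absolutelyContinuous' (by fun_prop) ?_
  filter_upwards [ae_restrict_mem measurableSet_Ioi] with r (hr : 0 < r)
  exact (ENNReal.ofReal_pos.2 (pow_pos hr n)).ne'

variable {E : Type*} [NormedAddCommGroup E] [NormedSpace ℝ E]

lemma integrable_radialMeasure_iff {n : ℕ} {f : ℝ → E} :
    Integrable f (radialMeasure n) ↔ Integrable (fun r => r ^ n • f r) halfLine := by
  rw [radialMeasure, integrable_withDensity_iff_integrable_smul' (by fun_prop)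
    (.of_forall fun _ => ENNReal.ofReal_lt_top)]
  refine integrable_congr ?_
  filter_upwards [ae_restrict_mem measurableSet_Ioi] with r (hr : 0 < r)
  rw [ENNReal.toReal_ofReal (pow_pos hr n).le]

lemma integral_radialMeasure (n : ℕ) (f : ℝ → E) :
    ∫ r, f r ∂radialMeasure n = ∫ r, r ^ n • f r ∂halfLine := by
  rw [radialMeasure, integral_withDensity_eq_integral_toReal_smul (by fun_prop)
    (.of_forall fun _ => ENNReal.ofReal_lt_top)]
  refine setIntegral_congr_fun measurableSet_Ioi fun r (hr : 0 < r) => ?_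
  simp only [ENNReal.toReal_ofReal (pow_pos hr n).le]

lemma measurePreserving_subtypeVal_volumeIoiPow (n : ℕ) :
    MeasurePreserving (Subtype.val : Set.Ioi (0 : ℝ) → ℝ) (Measure.volumeIoiPow n)
      (radialMeasure n) := by
  refine ⟨measurable_subtype_coe, ?_⟩
  ext A hA
  rw [Measure.map_apply measurable_subtype_coe hA, Measure.volumeIoiPow, radialMeasure,
    withDensity_apply _ (measurable_subtype_coe hA), withDensity_apply _ hA,
    setLIntegral_subtype measurableSet_Ioi _ fun r : ℝ => ENNReal.ofReal (r ^ n),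
    Measure.restrict_restrict hA, Subtype.image_preimage_coe, Set.inter_comm]

end RadialMeasure

section Polar

open scoped InnerProductSpace

/-- Surface measure on the unit sphere. -/
noncomputable abbrev sphereMeasure (V : Type*) [NormedAddCommGroup V] [InnerProductSpace ℝ V]
    [FiniteDimensional ℝ V] [MeasurableSpace V] [BorelSpace V] :
    Measure (Metric.sphere (0 : V) 1) :=
  (volume : Measure V).toSphere

variable {V : Type*} [NormedAddCommGroup V] [InnerProductSpace ℝ V]

lemma norm_smul_sphere {r : ℝ} (hr : 0 ≤ r) (ω : Metric.sphere (0 : V) 1) :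
    ‖r • (ω : V)‖ = r := by
  rw [norm_smul, norm_eq_of_mem_sphere, mul_one, Real.norm_of_nonneg hr]

variable [FiniteDimensional ℝ V] [MeasurableSpace V] [BorelSpace V]

lemma measurePreserving_polar [Nontrivial V] :
    MeasurePreserving (fun p : ℝ × Metric.sphere (0 : V) 1 => p.1 • (p.2 : V))
      ((radialMeasure (Module.finrank ℝ V - 1)).prod (sphereMeasure V)) volume := by
  have radial_val : MeasurePreserving (Prod.map id Subtype.val :
      Metric.sphere (0 : V) 1 × Set.Ioi (0 : ℝ) → Metric.sphere (0 : V) 1 × ℝ)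
      ((sphereMeasure V).prod (Measure.volumeIoiPow (Module.finrank ℝ V - 1)))
      ((sphereMeasure V).prod (radialMeasure (Module.finrank ℝ V - 1))) :=
    (MeasurePreserving.id _).prod (measurePreserving_subtypeVal_volumeIoiPow _)
  have punctured_val : MeasurePreserving (Subtype.val : ({0}ᶜ : Set V) → V)
      ((volume : Measure V).comap Subtype.val) volume := by
    refine ⟨measurable_subtype_coe, ?_⟩
    rw [map_comap_subtype_coe (measurableSet_singleton _).compl, restrict_compl_singleton]
  have punctured_polar := punctured_val.comp
    (MeasurePreserving.symm (homeomorphUnitSphereProd V).toMeasurableEquiv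
      (volume : Measure V).measurePreserving_homeomorphUnitSphereProd)
  have measurable_polar :
      Measurable fun p : Metric.sphere (0 : V) 1 × ℝ => p.2 • (p.1 : V) := by fun_prop
  have polar : MeasurePreserving (fun p : Metric.sphere (0 : V) 1 × ℝ => p.2 • (p.1 : V))
      ((sphereMeasure V).prod (radialMeasure (Module.finrank ℝ V - 1))) volume := by
    refine ⟨measurable_polar, ?_⟩
    rw [← radial_val.map_eq, Measure.map_map measurable_polar radial_val.measurable,
      ← punctured_polar.map_eq]
    congr 1
  exact polar.comp Measure.measurePreserving_swap

lemma memLp_inner_pow_sphere (e : V) (k : ℕ) (p : ENNReal) :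
    MemLp (fun ω : Metric.sphere (0 : V) 1 => (⟪e, (ω : V)⟫_ℝ : ℂ) ^ k) p (sphereMeasure V) := by
  have continuous_inner_pow :
      Continuous fun ω : Metric.sphere (0 : V) 1 => (⟪e, (ω : V)⟫_ℝ : ℂ) ^ k := by fun_prop
  obtain ⟨C, hC⟩ := isCompact_univ.exists_bound_of_continuousOn continuous_inner_pow.continuousOn
  exact MemLp.of_bound continuous_inner_pow.aestronglyMeasurable C
    (.of_forall fun ω => hC ω (Set.mem_univ ω))

/-- The spherical average `r ^ (n / 2) ∫ ⟨e, ω⟩ ^ k F(r ω) dω` with `n = dim V - 1`. The power of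
`r` makes `F ↦ radialPart F e k` bounded from `L²(V)` to `L²(0, ∞)`. -/
noncomputable def radialPart (F : V → ℂ) (e : V) (k : ℕ) (r : ℝ) : ℂ :=
  r ^ (((Module.finrank ℝ V - 1 : ℕ) : ℝ) / 2) •
    ∫ ω : Metric.sphere (0 : V) 1, (⟪e, (ω : V)⟫_ℝ : ℂ) ^ k * F (r • (ω : V)) ∂sphereMeasure V

lemma aestronglyMeasurable_radialPart [Nontrivial V] {F : V → ℂ} (hF : AEStronglyMeasurable F)
    (e : V) (k : ℕ) : AEStronglyMeasurable (radialPart F e k) halfLine := by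
  have continuous_rpow : Continuous fun r : ℝ =>
      r ^ (((Module.finrank ℝ V - 1 : ℕ) : ℝ) / 2) := Real.continuous_rpow_const (by positivity)
  have continuous_inner_pow : Continuous fun p : ℝ × Metric.sphere (0 : V) 1 =>
      (⟪e, (p.2 : V)⟫_ℝ : ℂ) ^ k := by fun_prop
  exact continuous_rpow.aestronglyMeasurable.smul
    ((continuous_inner_pow.aestronglyMeasurable.mul
      (hF.comp_measurePreserving measurePreserving_polar)).integral_prod_right'.mono_ac
      (halfLine_absolutelyContinuous_radialMeasure _))

lemma sq_norm_radialPart_le {F : V → ℂ} (e : V) (k : ℕ) {r : ℝ} (hr : 0 ≤ r)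
    (hF : MemLp (fun ω : Metric.sphere (0 : V) 1 => F (r • (ω : V))) 2 (sphereMeasure V)) :
    ‖radialPart F e k r‖ ^ 2 ≤
      (∫ ω : Metric.sphere (0 : V) 1, ‖(⟪e, (ω : V)⟫_ℝ : ℂ) ^ k‖ ^ 2 ∂sphereMeasure V) *
        (r ^ (Module.finrank ℝ V - 1) •
          ∫ ω : Metric.sphere (0 : V) 1, ‖F (r • (ω : V))‖ ^ 2 ∂sphereMeasure V) := by
  have rpow_half_sq : (r ^ (((Module.finrank ℝ V - 1 : ℕ) : ℝ) / 2)) ^ 2 =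
      r ^ (Module.finrank ℝ V - 1) := by
    rw [← Real.rpow_natCast, ← Real.rpow_mul hr, Nat.cast_two, div_mul_cancel₀ _ two_ne_zero,
      Real.rpow_natCast]
  rw [radialPart, norm_smul, mul_pow, Real.norm_eq_abs, sq_abs, rpow_half_sq, smul_eq_mul,
    mul_left_comm]
  gcongr
  exact sq_norm_integral_mul_le (memLp_inner_pow_sphere e k 2) hF

lemma memLp_radialPart [Nontrivial V] {F : V → ℂ} (hF : MemLp F 2) (e : V) (k : ℕ) :
    MemLp (radialPart F e k) 2 halfLine := by
  have ac := halfLine_absolutelyContinuous_radialMeasure (Module.finrank ℝ V - 1)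
  have memLp_polar := hF.comp_measurePreserving measurePreserving_polar
  have integrable_sq := (memLp_two_iff_integrable_sq_norm memLp_polar.1).1 memLp_polar
  have memLp_sphere : ∀ᵐ r ∂halfLine,
      MemLp (fun ω : Metric.sphere (0 : V) 1 => F (r • (ω : V))) 2 (sphereMeasure V) := by
    filter_upwards [ac.ae_le integrable_sq.prod_right_ae, ac.ae_le memLp_polar.1.prodMk_left]
      with r sq_integrable measurable
    exact (memLp_two_iff_integrable_sq_norm measurable).2 sq_integrable
  have measurable_radialPart := aestronglyMeasurable_radialPart hF.1 e k
  rw [memLp_two_iff_integrable_sq_norm measurable_radialPart]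
  refine ((integrable_radialMeasure_iff.1 integrable_sq.integral_prod_left).const_mul
    (∫ ω : Metric.sphere (0 : V) 1, ‖(⟪e, (ω : V)⟫_ℝ : ℂ) ^ k‖ ^ 2 ∂sphereMeasure V)).mono'
    (measurable_radialPart.norm.pow 2) ?_
  filter_upwards [memLp_sphere, ae_restrict_mem measurableSet_Ioi] with r hFr (hr : 0 < r)
  rw [Real.norm_eq_abs, abs_of_nonneg (by positivity)]
  exact sq_norm_radialPart_le e k hr.le hFr

lemma radialPart_ae_eq_zero [Nontrivial V] {F : V → ℂ} {S : Set ℝ}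
    (hF : ∀ᵐ x : V, ‖x‖ ∉ S → F x = 0) (e : V) (k : ℕ) :
    ∀ᵐ r ∂halfLine, r ∉ S → radialPart F e k r = 0 := by
  have ae_polar := Measure.ae_ae_of_ae_prod (measurePreserving_polar.quasiMeasurePreserving.ae hF)
  filter_upwards [(halfLine_absolutelyContinuous_radialMeasure _).ae_le ae_polar,
    ae_restrict_mem measurableSet_Ioi] with r hFr (hr : 0 < r) hrS
  rw [radialPart, integral_eq_zero_of_ae, smul_zero]
  filter_upwards [hFr] with ω hω
  rw [norm_smul_sphere hr.le] at hω
  rw [hω hrS, mul_zero, Pi.zero_apply]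

lemma integrable_exp_smul_inner_pow_mul {F : V → ℂ} (hF : MemLp F 2) (e : V) (k : ℕ) {s : ℝ}
    (hs : 0 < s) :
    Integrable fun v => Real.exp (-(Real.pi * s) * ‖v‖ ^ 2) • ((⟪e, v⟫_ℝ : ℂ) ^ k * F v) := by
  have continuous_gaussian : Continuous fun v : V => Real.exp (-(Real.pi * s) * ‖v‖ ^ 2) := by
    fun_prop
  have continuous_inner_pow : Continuous fun v : V => (⟪e, v⟫_ℝ : ℂ) ^ k := by fun_prop
  have integrable_bound : Integrable fun v : V =>
      Real.exp (-(Real.pi * s) * ‖v‖ ^ 2 + ‖e‖ * ‖v‖) * ‖F v‖ :=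
    memLp_one_iff_integrable.1
      (hF.norm.mul (memLp_exp_neg_mul_sq_norm_add (mul_pos Real.pi_pos hs) _))
  refine (integrable_bound.const_mul (k.factorial : ℝ)).mono'
    (continuous_gaussian.aestronglyMeasurable.smul
      (continuous_inner_pow.aestronglyMeasurable.mul hF.1)) (.of_forall fun v => ?_)
  have inner_pow_le : |⟪e, v⟫_ℝ| ^ k ≤ k.factorial * Real.exp (‖e‖ * ‖v‖) := by
    have pow_le := Real.pow_div_factorial_le_exp (‖e‖ * ‖v‖) (by positivity) k
    rw [div_le_iff₀' (by positivity)] at pow_le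
    exact (pow_le_pow_left₀ (abs_nonneg _) (abs_real_inner_le_norm e v) k).trans pow_le
  calc ‖Real.exp (-(Real.pi * s) * ‖v‖ ^ 2) • ((⟪e, v⟫_ℝ : ℂ) ^ k * F v)‖
      = Real.exp (-(Real.pi * s) * ‖v‖ ^ 2) * (|⟪e, v⟫_ℝ| ^ k * ‖F v‖) := by
        rw [norm_smul, norm_mul, norm_pow, Complex.norm_real, Real.norm_eq_abs, Real.norm_eq_abs,
          Real.abs_exp]
    _ ≤ Real.exp (-(Real.pi * s) * ‖v‖ ^ 2) * (k.factorial * Real.exp (‖e‖ * ‖v‖) * ‖F v‖) := by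
        gcongr
    _ = _ := by
        rw [Real.exp_add]
        ring

lemma gaussianMoment_eq_integral_radialPart [Nontrivial V] {F : V → ℂ} (hF : MemLp F 2) (e : V)
    (k : ℕ) {s : ℝ} (hs : 0 < s) :
    gaussianMoment F e k s =
      ∫ r, weightedGaussian (k + ((Module.finrank ℝ V - 1 : ℕ) : ℝ) / 2) s r •
        radialPart F e k r ∂halfLine := by
  have integrable_moment := integrable_exp_smul_inner_pow_mul hF e k hs
  have polar := measurePreserving_polar (V := V)
  set n := Module.finrank ℝ V - 1
  rw [gaussianMoment, ← polar.map_eq, integral_map polar.measurable.aemeasurable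
    (by rw [polar.map_eq]; exact integrable_moment.1)]
  refine (integral_prod _ (polar.integrable_comp_of_integrable integrable_moment)).trans ?_
  rw [integral_radialMeasure]
  refine setIntegral_congr_fun measurableSet_Ioi fun r (hr : 0 < r) => ?_
  have integrand_eq (ω : Metric.sphere (0 : V) 1) :
      Real.exp (-(Real.pi * s) * ‖r • (ω : V)‖ ^ 2) •
        ((⟪e, r • (ω : V)⟫_ℝ : ℂ) ^ k * F (r • (ω : V))) =
      (Real.exp (-(Real.pi * s) * r ^ 2) * r ^ k) •
        ((⟪e, (ω : V)⟫_ℝ : ℂ) ^ k * F (r • (ω : V))) := by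
    rw [norm_smul_sphere hr.le, inner_smul_right, Complex.real_smul, Complex.real_smul]
    push_cast
    ring
  have rpow_half_mul_self : r ^ n = r ^ ((n : ℝ) / 2) * r ^ ((n : ℝ) / 2) := by
    rw [← Real.rpow_add hr, add_halves, Real.rpow_natCast]
  simp only [Function.comp_apply, integrand_eq, integral_smul, radialPart, weightedGaussian,
    smul_smul]
  rw [Real.rpow_add hr, Real.rpow_natCast, rpow_half_mul_self]
  congr 1
  ring

lemma isHankelPair_radialPart [Nontrivial V] (F : Lp ℂ 2 (volume : Measure V)) (e : V) {k : ℕ}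
    (hF : ∀ j < k, ∀ s, 0 < s → gaussianMoment F e j s = 0)
    (hF' : ∀ j < k, ∀ s, 0 < s →
      gaussianMoment (𝓕 F : Lp ℂ 2 (volume : Measure V)) e j s = 0) :
    IsHankelPair (k + ((Module.finrank ℝ V - 1 : ℕ) : ℝ) / 2) (radialPart F e k)
      (Complex.I ^ k • radialPart (𝓕 F : Lp ℂ 2 (volume : Measure V)) e k) := by
  intro s hs
  have exponent_eq : (k : ℝ) + Module.finrank ℝ V / 2 =
      k + ((Module.finrank ℝ V - 1 : ℕ) : ℝ) / 2 + 1 / 2 := by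
    rw [Nat.cast_sub Module.finrank_pos, Nat.cast_one]
    ring
  have moment_eq := gaussianMoment_fourier F e hF hF' hs
  rw [gaussianMoment_eq_integral_radialPart (Lp.memLp F) e k hs, exponent_eq,
    gaussianMoment_eq_integral_radialPart (Lp.memLp _) e k (inv_pos.2 hs)] at moment_eq
  simp only [Pi.smul_apply, smul_comm _ (Complex.I ^ k), integral_smul]
  rw [moment_eq, smul_eq_mul, mul_smul_comm]

lemma gaussianMoment_eq_zero_of_radialPart_ae_eq_zero [Nontrivial V] {F : V → ℂ} (hF : MemLp F 2)
    {e : V} {k : ℕ} (h : radialPart F e k =ᵐ[halfLine] 0) {s : ℝ} (hs : 0 < s) :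
    gaussianMoment F e k s = 0 := by
  rw [gaussianMoment_eq_integral_radialPart hF e k hs]
  refine integral_eq_zero_of_ae ?_
  filter_upwards [h] with r hr
  rw [hr, Pi.zero_apply, smul_zero]

lemma gaussianMoment_eq_zero_of_radial_support [Nontrivial V] (F : Lp ℂ 2 (volume : Measure V))
    {S T : Set ℝ} (hS : halfLine S < ⊤) (hT : halfLine T < ⊤)
    (hFS : ∀ᵐ x : V, ‖x‖ ∉ S → F x = 0)
    (hFT : ∀ᵐ x : V, ‖x‖ ∉ T → (𝓕 F : Lp ℂ 2 (volume : Measure V)) x = 0) (e : V) (k : ℕ) :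
    (∀ s, 0 < s → gaussianMoment F e k s = 0) ∧
      ∀ s, 0 < s → gaussianMoment (𝓕 F : Lp ℂ 2 (volume : Measure V)) e k s = 0 := by
  induction k using Nat.strong_induction_on with
  | _ k ih =>
  let G : Lp ℂ 2 (volume : Measure V) := 𝓕 F
  have order_nonneg : 0 ≤ (k : ℝ) + ((Module.finrank ℝ V - 1 : ℕ) : ℝ) / 2 := by positivity
  have pair := isHankelPair_radialPart F e (fun j hj => (ih j hj).1) (fun j hj => (ih j hj).2)
  have memLp_F := memLp_radialPart (Lp.memLp F) e k
  have memLp_G := (memLp_radialPart (Lp.memLp G) e k).const_smul (Complex.I ^ k)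
  have support_F := radialPart_ae_eq_zero hFS e k
  have support_G : ∀ᵐ r ∂halfLine, r ∉ T → (Complex.I ^ k • radialPart G e k) r = 0 :=
    (radialPart_ae_eq_zero hFT e k).mono fun r hr hrT => by
      rw [Pi.smul_apply, hr hrT, smul_zero]
  have radialPart_F := pair.ae_eq_zero order_nonneg memLp_F memLp_G hS hT support_F support_G
  have radialPart_G : radialPart G e k =ᵐ[halfLine] 0 :=
    (pair.symm.ae_eq_zero order_nonneg memLp_G memLp_F hT hS support_G support_F).mono
      fun r hr => (smul_eq_zero.1 hr).resolve_left (pow_ne_zero _ Complex.I_ne_zero)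
  exact ⟨fun s hs => gaussianMoment_eq_zero_of_radialPart_ae_eq_zero (Lp.memLp F) radialPart_F hs,
    fun s hs => gaussianMoment_eq_zero_of_radialPart_ae_eq_zero (Lp.memLp G) radialPart_G hs⟩

lemma ae_eq_zero_of_fourier_eq_zero {h : V → ℂ} (h1 : Integrable h) (h2 : MemLp h 2)
    (h_fourier : ∀ w, 𝓕 h w = 0) : h =ᵐ[volume] 0 := by
  have fourier_toLp : (𝓕 (h2.toLp h) : Lp ℂ 2 (volume : Measure V)) = 0 :=
    Lp.eq_zero_iff_ae_eq_zero.2 ((fourier_toLp_ae_eq h1 h2).trans (.of_forall h_fourier))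
  have toLp_eq_zero : h2.toLp h = 0 := by
    rw [← norm_eq_zero, ← Lp.norm_fourier_eq, fourier_toLp, norm_zero]
  exact h2.coeFn_toLp.symm.trans (Lp.eq_zero_iff_ae_eq_zero.1 toLp_eq_zero)

/-- The moments are the Taylor coefficients of the Fourier transform of the Gaussian-weighted
`F`. -/
lemma ae_eq_zero_of_gaussianMoment_eq_zero {F : V → ℂ} (hF : MemLp F 2) {s : ℝ} (hs : 0 < s)
    (h : ∀ (e : V) (k : ℕ), gaussianMoment F e k s = 0) : F =ᵐ[volume] 0 := by
  let H : V → ℂ := fun v => Real.exp (-(Real.pi * s) * ‖v‖ ^ 2) • F v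
  have integrable_H : Integrable H := by
    simpa [H] using integrable_exp_smul_inner_pow_mul hF (0 : V) 0 hs
  have memLp_H : MemLp H 2 := by
    refine hF.mono integrable_H.1 (.of_forall fun v => ?_)
    rw [norm_smul, Real.norm_eq_abs, Real.abs_exp]
    refine mul_le_of_le_one_left (norm_nonneg _) (Real.exp_le_one_iff.2 ?_)
    rw [neg_mul, neg_nonpos]
    positivity
  have fourier_H (w : V) : 𝓕 H w = 0 := by
    have generating := hasSum_gaussianMoment hF w hs (-(2 * Real.pi * Complex.I))
    simp only [h, mul_zero] at generating
    rw [Real.fourier_eq', ← generating.unique hasSum_zero, gaussianGenerating]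
    refine integral_congr_ae (.of_forall fun v => ?_)
    simp only [H, smul_eq_mul, real_inner_comm w v, mul_smul_comm]
    push_cast
    ring_nf
  filter_upwards [ae_eq_zero_of_fourier_eq_zero integrable_H memLp_H fourier_H] with v hv
  exact (smul_eq_zero.1 hv).resolve_left (Real.exp_pos _).ne'

theorem corollary4p5_general [Nontrivial V] {S T : Set ℝ} (hS : volume S < ⊤) (hT : volume T < ⊤)
    (F : Lp ℂ 2 (volume : Measure V)) (hFS : ∀ᵐ x, ‖x‖ ∉ S → F x = 0)
    (hFT : ∀ᵐ x, ‖x‖ ∉ T → (𝓕 F : Lp ℂ 2 (volume : Measure V)) x = 0) : F = 0 := by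
  have halfLine_S := (Measure.restrict_apply_le (Set.Ioi 0) S).trans_lt hS
  have halfLine_T := (Measure.restrict_apply_le (Set.Ioi 0) T).trans_lt hT
  refine Lp.eq_zero_iff_ae_eq_zero.2
    (ae_eq_zero_of_gaussianMoment_eq_zero (Lp.memLp F) one_pos fun e k => ?_)
  exact (gaussianMoment_eq_zero_of_radial_support F halfLine_S halfLine_T hFS hFT e k).1 1 one_pos

end Polar

theorem corollary4p5 (d : ℕ) (hd : 1 ≤ d) (S T : Set ℝ)
    (hS : S ⊆ Set.Ici 0) (hT : T ⊆ Set.Ici 0)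
    (hSm : NullMeasurableSet S volume) (hTm : NullMeasurableSet T volume)
    (hS0 : 0 < volume S) (hSfin : volume S < ⊤)
    (hT0 : 0 < volume T) (hTfin : volume T < ⊤) :
    IsWeakAnnihilatingPair (radialSet d S) (radialSet d T) := by
  intro F hFS hFT
  have : Nonempty (Fin d) := ⟨⟨0, hd⟩⟩
  exact corollary4p5_general hSfin hTfin F hFS hFT
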